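/- Let $n\in\mathbb N$, $a<b$, $\tau>0$, $A,A_d\in L_\infty^{n\times 3n}[a,b]$ and $B\in\mathbb R^{2n\times 4n}$. Put $$X_B=\Big\{u\in H_2^n[a,b]\ :\ B\begin{bmatrix}u(a)\\u_x(a)\\u(b)\\u_x(b)\end{bmatrix}=0\Big\},\qquad Y_u=\big\{\phi\in H^n_{(1,2)}([0,1]\times[a,b])\ :\ \phi(0,\cdot)=u,\ \phi(s,\cdot)\in X_B\ \ \forall s\in[0,1]\big\},$$ where $H^n_{(1,2)}$ is the space of $\phi\in L_2^n$ with $\partial_s^i\partial_x^j\phi\in L_2^n$ (weak derivatives) for all $i\le1$, $j\le2$. Consider the delayed PDE $$u_t(t,x)=A(x)\begin{bmatrix}u(t,x)\\u_x(t,x)\\u_{xx}(t,x)\end{bmatrix}+A_d(x)\begin{bmatrix}u(t-\tau,x)\\u_x(t-\tau,x)\\u_{xx}(t-\tau,x)\end{bmatrix},\qquad u(t)\in X_B .$$ With the delayed state $\phi(t,s)=u(t-s\tau)$, a solution of it with initial state $(u_0,\phi_0)$ is a pair $(u,\phi)$, differentiable in $t\ge0$ with values in $L_2^n[a,b]\times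 L_2^n([0,1]\times[a,b])$, with $(u(0),\phi(0))=(u_0,\phi_0)$ and such that for all $t\ge0$: $u(t)\in X_B$, $\phi(t)\in Y_{u(t)}$, $$u_t(t)=A\begin{bmatrix}u(t)\\u_x(t)\\u_{xx}(t)\end{bmatrix}+A_d\begin{bmatrix}\phi(t,1)\\\phi_x(t,1)\\\phi_{xx}(t,1)\end{bmatrix},\qquad \phi_t(t)=-\tfrac1\tau\,\phi_s(t).$$ Let $$H=\begin{bmatrix}I_n&0\\0&I_n\\I_n&(b-a)I_n\\0&I_n\end{bmatrix},\quad Q(\theta)=\begin{bmatrix}0\\0\\(b-\theta)I_n\\I_n\end{bmatrix},\quad K(x)=\begin{bmatrix}I_n&(x-a)I_n\end{bmatrix},$$ assume that $BH$ is invertible, and set $T_2(x,\theta)=-K(x)(BH)^{-1}BQ(\theta)$, $T_1(x,\theta)=(x-\theta)I_n+T_2(x,\theta)$. For $v\in L_2^n[a,b]$ let $$(\mathcal T_1v)(x)=\int_a^xT_1(x,\theta)v(\theta)\,d\theta+\int_x^bT_2(x,\theta)v(\theta)\,d\theta ,$$ and for $C\in\{A,A_d\}$ let $$(\mathcal P_Cv)(x)=C(x)\begin{bmatrix}0\\0\\I_n\end{bmatrix}v(x)+\int_a^xC(x)\begin{bmatrix}T_1(x,\theta)\\\partial_xT_1(x,\theta)\\0\end{bmatrix}v(\theta)\,d\theta+\int_x^bC(x)\begin{bmatrix}T_2(x,\theta)\\\partial_xT_2(x,\theta)\\0\end{bmatrix}v(\theta)\,d\theta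 .$$ On the Hilbert space $Z=L_2^n[a,b]\times L_2^n([0,1]\times[a,b])$, with $\|(u,\phi)\|^2=\|u\|_{L_2}^2+\|\phi\|_{L_2}^2$, define the bounded operators $$\mathcal T\begin{bmatrix}v\\\psi\end{bmatrix}=\begin{bmatrix}\mathcal T_1v\\ \mathcal T_1v+\int_0^s\mathcal T_1\psi(\theta)\,d\theta\end{bmatrix},\qquad \mathcal A\begin{bmatrix}v\\\psi\end{bmatrix}=\begin{bmatrix}\mathcal P_Av+\mathcal P_{A_d}v+\int_0^1\mathcal P_{A_d}\psi(s)\,ds\\ -\frac1\tau\,\mathcal T_1\psi(s)\end{bmatrix}.$$ Let $\epsilon,\alpha>0$, and let $\mathcal P$ be a bounded linear operator on $Z$ (in particular, any partial integral operator) such that $$\mathcal P=\mathcal P^*,\qquad \mathcal P\succeq\epsilon^2I,\qquad \mathcal A^*\mathcal P\mathcal T+\mathcal T^*\mathcal P\mathcal A\preceq-2\alpha\,\mathcal T^*\mathcal P\mathcal T .$$ Then, with $\zeta=\sqrt{\|\mathcal P\|}$, every solution $(u,\phi)$ of the delayed PDE satisfies $$\|(u(t),\phi(t))\|\le\frac{\zeta}{\epsilon}\,\|(u(0),\phi(0))\|\,e^{-\alpha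 t}\qquad\text{for all }t\ge0 .$$ -/

import Mathlib

open MeasureTheory Set Filter
open scoped ENNReal NNReal Matrix ContDiff

noncomputable section

namespace DelayPDE

/-! ### Function spaces -/

/-- `ℝⁿ` with its Euclidean norm. -/
abbrev Vec (n : ℕ) : Type := EuclideanSpace ℝ (Fin n)

/-- Lebesgue measure on the interval `[a, b]`. -/
abbrev ivl (a b : ℝ) : Measure ℝ := volume.restrict (Icc a b)

/-- Lebesgue measure on the rectangle `[0, 1] × [a, b]`; points are written `(s, x)`. -/
abbrev rect (a b : ℝ) : Measure (ℝ × ℝ) := (ivl 0 1).prod (ivl a b)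

/-- `L₂ⁿ[a, b]`. -/
abbrev L2 (n : ℕ) (a b : ℝ) : Type := Lp (Vec n) 2 (ivl a b)

/-- `L₂ⁿ([0, 1] × [a, b])`. -/
abbrev L2R (n : ℕ) (a b : ℝ) : Type := Lp (Vec n) 2 (rect a b)

/-- The Hilbert space `L₂ⁿ[a, b] × L₂ⁿ([0, 1] × [a, b])`, with
`‖(u, φ)‖² = ‖u‖² + ‖φ‖²`. -/
abbrev Z (n : ℕ) (a b : ℝ) : Type := WithLp 2 (L2 n a b × L2R n a b)

/-! ### Three elementary bounded operators between `L₂` spaces -/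

section Elementary

variable {n : ℕ} {X Y : Type} [MeasurableSpace X] [MeasurableSpace Y]

theorem memLp_comp {μ : Measure X} {ν : Measure Y} {ι : X → Y} (hι : Measurable ι) (c : ℝ≥0)
    (h : μ.map ι ≤ (c : ℝ≥0∞) • ν) (v : Lp (Vec n) 2 ν) : MemLp (fun x => v (ι x)) 2 μ :=
  ((Lp.memLp v).of_measure_le_smul ENNReal.coe_ne_top h).comp_of_map hι.aemeasurable

theorem quasi_of_le {μ : Measure X} {ν : Measure Y} {ι : X → Y} (hι : Measurable ι) (c : ℝ≥0)
    (h : μ.map ι ≤ (c : ℝ≥0∞) • ν) : Measure.QuasiMeasurePreserving ι μ ν :=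
  ⟨hι, (Measure.absolutelyContinuous_of_le h).trans
    (Measure.smul_absolutelyContinuous)⟩

/-- Composition `v ↦ v ∘ ι`. -/
def pull {μ : Measure X} {ν : Measure Y} (ι : X → Y) (hι : Measurable ι) (c : ℝ≥0)
    (h : μ.map ι ≤ (c : ℝ≥0∞) • ν) : Lp (Vec n) 2 ν →L[ℝ] Lp (Vec n) 2 μ :=
  LinearMap.mkContinuous
    { toFun := fun v => (memLp_comp hι c h v).toLp (fun x => v (ι x))
      map_add' := fun v w => by
        rw [← MemLp.toLp_add]
        apply MemLp.toLp_congr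
        exact (quasi_of_le hι c h).ae (Lp.coeFn_add v w)
      map_smul' := fun r v => by
        rw [RingHom.id_apply, ← MemLp.toLp_const_smul]
        apply MemLp.toLp_congr
        exact (quasi_of_le hι c h).ae (Lp.coeFn_smul r v) }
    ((c : ℝ≥0∞) ^ (1 / (2 : ℝ≥0∞)).toReal).toReal
    (fun v => by
      rw [LinearMap.coe_mk, AddHom.coe_mk, Lp.norm_toLp, Lp.norm_def, ← ENNReal.toReal_mul]
      apply ENNReal.toReal_mono
      · exact ENNReal.mul_ne_top (by simp) (Lp.eLpNorm_ne_top v)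
      · have hm : AEStronglyMeasurable v (μ.map ι) :=
          ((Lp.memLp v).of_measure_le_smul ENNReal.coe_ne_top h).1
        have h1 := eLpNorm_map_measure (p := 2) hm hι.aemeasurable
        have h2 := eLpNorm_mono_measure (p := 2) v h
        rw [eLpNorm_smul_measure_of_ne_top (by simp)] at h2
        rw [h1] at h2
        exact h2)

theorem pull_apply {μ : Measure X} {ν : Measure Y} (ι : X → Y) (hι : Measurable ι) (c : ℝ≥0)
    (h : μ.map ι ≤ (c : ℝ≥0∞) • ν) (v : Lp (Vec n) 2 ν) :
    ∀ᵐ x ∂μ, pull ι hι c h v x = v (ι x) :=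
  MemLp.coeFn_toLp (memLp_comp hι c h v)

theorem memLp_sum_smul {F : Type*} [NormedAddCommGroup F] [NormedSpace ℝ F] {μ : Measure X}
    {f : Fin n → Fin n → X → ℝ} (hf : ∀ i j, MemLp (f i j) ⊤ μ) (e : Fin n → Fin n → F) :
    MemLp (fun x => ∑ i, ∑ j, f i j x • e i j) ⊤ μ := by
  refine memLp_finsetSum _ fun i _ => memLp_finsetSum _ fun j _ => ?_
  exact MemLp.smul (p := ⊤) (q := ⊤) (r := ⊤) (memLp_top_const (e i j)) (hf i j)

theorem memLp_matrix {μ : Measure X} {M : X → Matrix (Fin n) (Fin n) ℝ}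
    (hM : ∀ i j, MemLp (fun x => M x i j) ⊤ μ) :
    MemLp (fun x => Matrix.toEuclideanCLM (n := Fin n) (𝕜 := ℝ) (M x)) ⊤ μ := by
  have : (fun x => Matrix.toEuclideanCLM (n := Fin n) (𝕜 := ℝ) (M x)) =
      fun x => ∑ i, ∑ j, M x i j •
        Matrix.toEuclideanCLM (n := Fin n) (𝕜 := ℝ) (Matrix.single i j 1) := by
    funext x
    conv_lhs => rw [Matrix.matrix_eq_sum_single (M x)]
    simp only [map_sum]
    refine Finset.sum_congr rfl fun i _ => Finset.sum_congr rfl fun j _ => ?_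
    rw [← map_smul, Matrix.smul_single, smul_eq_mul, mul_one]
  rw [this]
  exact memLp_sum_smul hM _

/-- Multiplication by an essentially bounded matrix-valued function. -/
def mulOp {μ : Measure X} (M : X → Matrix (Fin n) (Fin n) ℝ)
    (hM : ∀ i j, MemLp (fun x => M x i j) ⊤ μ) : Lp (Vec n) 2 μ →L[ℝ] Lp (Vec n) 2 μ :=
  (ContinuousLinearMap.id ℝ (Vec n →L[ℝ] Vec n)).holderL μ ⊤ 2 2 ((memLp_matrix hM).toLp _)

theorem mulOp_apply {μ : Measure X} (M : X → Matrix (Fin n) (Fin n) ℝ)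
    (hM : ∀ i j, MemLp (fun x => M x i j) ⊤ μ) (v : Lp (Vec n) 2 μ) :
    ∀ᵐ x ∂μ, mulOp M hM v x = WithLp.toLp 2 (M x *ᵥ (v x).ofLp) := by
  have h1 := (ContinuousLinearMap.id ℝ (Vec n →L[ℝ] Vec n)).coeFn_holder (r := 2)
    ((memLp_matrix hM).toLp _) v
  filter_upwards [h1, MemLp.coeFn_toLp (memLp_matrix hM)] with x h2 h3
  refine h2.trans ?_
  rw [h3]
  rfl

theorem eLpNorm_integral_le {μ : Measure X} {ρ : Measure Y} [IsFiniteMeasure μ] [IsFiniteMeasure ρ]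
    (v : Lp (Vec n) 2 (μ.prod ρ)) :
    eLpNorm (fun x => ∫ y, v (x, y) ∂ρ) 2 μ ≤
      (ρ univ) ^ (1 / 2 : ℝ) * eLpNorm v 2 (μ.prod ρ) := by
  have hm : AEStronglyMeasurable v (μ.prod ρ) := (Lp.memLp v).1
  have key : ∀ᵐ x ∂μ, ‖∫ y, v (x, y) ∂ρ‖ₑ ^ (2 : ℝ) ≤
      ρ univ * ∫⁻ y, ‖v (x, y)‖ₑ ^ (2 : ℝ) ∂ρ := by
    filter_upwards [hm.prodMk_left] with x hx
    have h1 : ‖∫ y, v (x, y) ∂ρ‖ₑ ≤ eLpNorm (fun y => v (x, y)) 1 ρ := by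
      rw [eLpNorm_one_eq_lintegral_enorm]
      exact enorm_integral_le_lintegral_enorm _
    have h2 := eLpNorm_le_eLpNorm_mul_rpow_measure_univ (p := 1) (q := 2) (by norm_num) hx
    have h3 := ENNReal.rpow_le_rpow (h1.trans h2) (z := 2) (by norm_num)
    refine h3.trans (le_of_eq ?_)
    rw [ENNReal.mul_rpow_of_nonneg _ _ (by norm_num), ← ENNReal.rpow_mul,
      eLpNorm_eq_lintegral_rpow_enorm_toReal (by norm_num) (by norm_num), ← ENNReal.rpow_mul]
    norm_num
    rw [mul_comm]
  have hme : AEMeasurable (fun z => ‖v z‖ₑ ^ (2 : ℝ)) (μ.prod ρ) := hm.enorm.pow_const _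
  rw [eLpNorm_eq_lintegral_rpow_enorm_toReal (by norm_num) (by norm_num),
    eLpNorm_eq_lintegral_rpow_enorm_toReal (by norm_num) (by norm_num)]
  simp only [ENNReal.toReal_ofNat]
  rw [← ENNReal.mul_rpow_of_nonneg _ _ (by norm_num)]
  refine ENNReal.rpow_le_rpow ?_ (by norm_num)
  rw [lintegral_prod _ hme, ← lintegral_const_mul' _ _ (measure_ne_top _ _)]
  exact lintegral_mono_ae key

theorem memLp_integral {μ : Measure X} {ρ : Measure Y} [IsFiniteMeasure μ] [IsFiniteMeasure ρ]
    (v : Lp (Vec n) 2 (μ.prod ρ)) : MemLp (fun x => ∫ y, v (x, y) ∂ρ) 2 μ :=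
  ⟨(Lp.memLp v).1.integral_prod_right', (eLpNorm_integral_le v).trans_lt
    (ENNReal.mul_lt_top (ENNReal.rpow_lt_top_of_nonneg (by norm_num) (measure_ne_top _ _))
      (Lp.eLpNorm_lt_top v))⟩

theorem integrable_slice {μ : Measure X} {ρ : Measure Y} [IsFiniteMeasure μ]
    [IsFiniteMeasure ρ] (v : Lp (Vec n) 2 (μ.prod ρ)) :
    ∀ᵐ x ∂μ, Integrable (fun y => v (x, y)) ρ :=
  ((Lp.memLp v).integrable (by norm_num)).prod_right_ae

/-- Integration over the second variable, `v ↦ ∫ v(·, y) dρ(y)`. -/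
def intOp (μ : Measure X) (ρ : Measure Y) [IsFiniteMeasure μ] [IsFiniteMeasure ρ] :
    Lp (Vec n) 2 (μ.prod ρ) →L[ℝ] Lp (Vec n) 2 μ :=
  LinearMap.mkContinuous
    { toFun := fun v => (memLp_integral v).toLp (fun x => ∫ y, v (x, y) ∂ρ)
      map_add' := fun v w => by
        rw [← MemLp.toLp_add]
        apply MemLp.toLp_congr
        filter_upwards [Measure.ae_ae_of_ae_prod (Lp.coeFn_add v w), integrable_slice v,
          integrable_slice w] with x h1 h2 h3
        rw [Pi.add_apply, ← integral_add h2 h3]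
        exact integral_congr_ae h1
      map_smul' := fun r v => by
        rw [RingHom.id_apply, ← MemLp.toLp_const_smul]
        apply MemLp.toLp_congr
        filter_upwards [Measure.ae_ae_of_ae_prod (Lp.coeFn_smul r v)] with x h1
        rw [Pi.smul_apply, ← integral_smul]
        exact integral_congr_ae h1 }
    ((ρ univ) ^ (1 / 2 : ℝ)).toReal
    (fun v => by
      rw [LinearMap.coe_mk, AddHom.coe_mk, Lp.norm_toLp, Lp.norm_def, ← ENNReal.toReal_mul]
      exact ENNReal.toReal_mono (ENNReal.mul_ne_top (by simp) (Lp.eLpNorm_ne_top v))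
        (eLpNorm_integral_le v))

theorem intOp_apply {μ : Measure X} {ρ : Measure Y} [IsFiniteMeasure μ] [IsFiniteMeasure ρ]
    (v : Lp (Vec n) 2 (μ.prod ρ)) :
    ∀ᵐ x ∂μ, intOp μ ρ v x = ∫ y, v (x, y) ∂ρ :=
  MemLp.coeFn_toLp (memLp_integral v)

end Elementary

/-! ### 3-PI operators and partial integration along `s` -/

section PI

variable {n : ℕ} {a b : ℝ}

/-- Total mass of Lebesgue measure on `[a, b]`. -/
def mass (a b : ℝ) : ℝ≥0 := (ivl a b univ).toNNReal

theorem coe_mass (a b : ℝ) : (mass a b : ℝ≥0∞) = ivl a b univ :=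
  ENNReal.coe_toNNReal (measure_ne_top _ _)

theorem map_kernel (a b : ℝ) :
    ((ivl a b).prod (ivl a b)).map Prod.snd ≤ (mass a b : ℝ≥0∞) • ivl a b := by
  rw [Measure.map_snd_prod, coe_mass]

theorem map_lift (a b : ℝ) :
    ((rect a b).prod (ivl a b)).map (fun z => (z.1.1, z.2)) ≤ (mass a b : ℝ≥0∞) • rect a b := by
  have h := Measure.map_prod_map (rect a b) (ivl a b) (measurable_fst (α := ℝ) (β := ℝ))
    (measurable_id (α := ℝ))
  rw [Measure.map_fst_prod, Measure.map_id, Measure.prod_smul_left] at h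
  rw [coe_mass, h]
  rfl

theorem map_volterra (a b : ℝ) :
    ((rect a b).prod (ivl 0 1)).map (fun z => (z.2, z.1.2)) ≤ (mass 0 1 : ℝ≥0∞) • rect a b := by
  have h := Measure.map_prod_map (rect a b) (ivl 0 1) (measurable_snd (α := ℝ) (β := ℝ))
    (measurable_id (α := ℝ))
  rw [Measure.map_snd_prod, Measure.map_id, Measure.prod_smul_left] at h
  have h' := congrArg (Measure.map Prod.swap) h
  rw [Measure.map_smul, Measure.prod_swap,
    Measure.map_map measurable_swap (measurable_snd.prodMap measurable_id)] at h'
  rw [coe_mass, h']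
  rfl

theorem map_swap (a b : ℝ) :
    ((ivl a b).prod (ivl 0 1)).map Prod.swap ≤ ((1 : ℝ≥0) : ℝ≥0∞) • rect a b := by
  rw [Measure.prod_swap, ENNReal.coe_one, one_smul]

theorem map_const (a b : ℝ) :
    (rect a b).map Prod.snd ≤ (mass 0 1 : ℝ≥0∞) • ivl a b := by
  rw [Measure.map_snd_prod, coe_mass]

/-- Parameters `{R₀, R₁, R₂}` of a 3-PI operator on `L₂ⁿ[a, b]`, with essentially bounded
entries. -/
structure ThreePI (n : ℕ) (a b : ℝ) where
  R0 : ℝ → Matrix (Fin n) (Fin n) ℝ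
  R1 : ℝ → ℝ → Matrix (Fin n) (Fin n) ℝ
  R2 : ℝ → ℝ → Matrix (Fin n) (Fin n) ℝ
  memLp_R0 : ∀ i j, MemLp (fun x => R0 x i j) ⊤ (ivl a b)
  memLp_R1 : ∀ i j, MemLp (fun z : ℝ × ℝ => R1 z.1 z.2 i j) ⊤ ((ivl a b).prod (ivl a b))
  memLp_R2 : ∀ i j, MemLp (fun z : ℝ × ℝ => R2 z.1 z.2 i j) ⊤ ((ivl a b).prod (ivl a b))

namespace ThreePI

/-- The integral kernel: `R₁(x, θ)` for `θ ≤ x` and `R₂(x, θ)` for `θ > x`. -/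
def ker (R : ThreePI n a b) (z : ℝ × ℝ) : Matrix (Fin n) (Fin n) ℝ :=
  if z.2 ≤ z.1 then R.R1 z.1 z.2 else R.R2 z.1 z.2

theorem memLp_ker (R : ThreePI n a b) (i j : Fin n) :
    MemLp (fun z => R.ker z i j) ⊤ ((ivl a b).prod (ivl a b)) := by
  have hs : MeasurableSet {z : ℝ × ℝ | z.2 ≤ z.1} := measurableSet_le measurable_snd measurable_fst
  have h := MemLp.piecewise hs ((R.memLp_R1 i j).restrict _) ((R.memLp_R2 i j).restrict _)
  convert h using 1
  funext z
  simp only [ker, Set.piecewise, Set.mem_ofPred_eq]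
  split_ifs <;> rfl

theorem memLp_ker_lift (R : ThreePI n a b) (i j : Fin n) :
    MemLp (fun z : (ℝ × ℝ) × ℝ => R.ker (z.1.2, z.2) i j) ⊤ ((rect a b).prod (ivl a b)) := by
  have h := Measure.map_prod_map (rect a b) (ivl a b) (measurable_snd (α := ℝ) (β := ℝ))
    (measurable_id (α := ℝ))
  rw [Measure.map_snd_prod, Measure.map_id, Measure.prod_smul_left] at h
  refine MemLp.comp_of_map (f := Prod.map Prod.snd id) (g := fun z => R.ker z i j) ?_
    (measurable_snd.prodMap measurable_id).aemeasurable
  rw [← h]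
  exact (R.memLp_ker i j).smul_measure (measure_ne_top _ _)

/-- The 3-PI operator on `L₂ⁿ[a, b]` with the given parameters; see `ThreePI.op_apply`. -/
def op (R : ThreePI n a b) : L2 n a b →L[ℝ] L2 n a b :=
  mulOp R.R0 R.memLp_R0 +
    intOp (ivl a b) (ivl a b) ∘L mulOp R.ker R.memLp_ker ∘L
      pull Prod.snd measurable_snd (mass a b) (map_kernel a b)

/-- The same 3-PI operator acting on `L₂ⁿ([0, 1] × [a, b])` in the variable `x`, as a multiplier
along `s`; see `ThreePI.lift_apply`. -/
def lift (R : ThreePI n a b) : L2R n a b →L[ℝ] L2R n a b :=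
  mulOp (fun z => R.R0 z.2) (fun i j => (R.memLp_R0 i j).comp_snd (ivl 0 1)) +
    intOp (rect a b) (ivl a b) ∘L mulOp (fun z => R.ker (z.1.2, z.2)) R.memLp_ker_lift ∘L
      pull (fun z => (z.1.1, z.2)) (by fun_prop) (mass a b) (map_lift a b)

/-- Splitting of the kernel integral into its two parts. -/
theorem integral_ker (R : ThreePI n a b) {x : ℝ} (hx : x ∈ Icc a b) {v : ℝ → Vec n}
    (hv : Integrable (fun θ => WithLp.toLp 2 (R.ker (x, θ) *ᵥ (v θ).ofLp)) (ivl a b)) :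
    ∫ θ, WithLp.toLp 2 (R.ker (x, θ) *ᵥ (v θ).ofLp) ∂(ivl a b) =
      (∫ θ in a..x, WithLp.toLp 2 (R.R1 x θ *ᵥ (v θ).ofLp)) +
        ∫ θ in x..b, WithLp.toLp 2 (R.R2 x θ *ᵥ (v θ).ofLp) := by
  have hi : IntegrableOn (fun θ => WithLp.toLp 2 (R.ker (x, θ) *ᵥ (v θ).ofLp)) (Icc a b) := hv
  have hab : a ≤ b := hx.1.trans hx.2
  rw [integral_Icc_eq_integral_Ioc, ← intervalIntegral.integral_of_le hab,
    ← intervalIntegral.integral_add_adjacent_intervals (b := x)]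
  · congr 1
    · refine intervalIntegral.integral_congr_ae (ae_of_all _ fun θ hθ => ?_)
      rw [uIoc_of_le hx.1] at hθ
      simp [ker, hθ.2]
    · refine intervalIntegral.integral_congr_ae (ae_of_all _ fun θ hθ => ?_)
      rw [uIoc_of_le hx.2] at hθ
      simp [ker, not_le.2 hθ.1]
  · exact (intervalIntegrable_iff_integrableOn_Icc_of_le hx.1).2
      (hi.mono_set (Icc_subset_Icc_right hx.2))
  · exact (intervalIntegrable_iff_integrableOn_Icc_of_le hx.2).2
      (hi.mono_set (Icc_subset_Icc_left hx.1))

theorem op_apply (R : ThreePI n a b) (v : L2 n a b) :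
    ∀ᵐ x ∂(ivl a b), R.op v x = WithLp.toLp 2 (R.R0 x *ᵥ (v x).ofLp) +
      ((∫ θ in a..x, WithLp.toLp 2 (R.R1 x θ *ᵥ (v θ).ofLp)) +
        ∫ θ in x..b, WithLp.toLp 2 (R.R2 x θ *ᵥ (v θ).ofLp)) := by
  set w := pull (n := n) Prod.snd measurable_snd (mass a b) (map_kernel a b) v with hw
  set y := mulOp R.ker R.memLp_ker w with hy
  have e0 : R.op v = mulOp R.R0 R.memLp_R0 v + intOp (ivl a b) (ivl a b) y := rfl
  rw [e0]
  filter_upwards [Lp.coeFn_add (mulOp R.R0 R.memLp_R0 v) (intOp (ivl a b) (ivl a b) y),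
    mulOp_apply R.R0 R.memLp_R0 v, intOp_apply y, integrable_slice y,
    Measure.ae_ae_of_ae_prod (mulOp_apply R.ker R.memLp_ker w),
    Measure.ae_ae_of_ae_prod
      (pull_apply Prod.snd measurable_snd (mass a b) (map_kernel a b) v),
    ae_restrict_mem measurableSet_Icc] with x h1 h2 h3 h4 h5 h6 hx
  have h7 : (fun θ => y (x, θ)) =ᵐ[ivl a b]
      fun θ => WithLp.toLp 2 (R.ker (x, θ) *ᵥ (v θ).ofLp) := by
    filter_upwards [h5, h6] with θ h8 h9
    rw [hy, h8, hw, h9]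
  rw [h1, Pi.add_apply, h2, h3, integral_congr_ae h7, R.integral_ker hx (h4.congr h7)]

theorem lift_apply (R : ThreePI n a b) (v : L2R n a b) :
    ∀ᵐ z ∂(rect a b), R.lift v z = WithLp.toLp 2 (R.R0 z.2 *ᵥ (v z).ofLp) +
      ((∫ θ in a..z.2, WithLp.toLp 2 (R.R1 z.2 θ *ᵥ (v (z.1, θ)).ofLp)) +
        ∫ θ in z.2..b, WithLp.toLp 2 (R.R2 z.2 θ *ᵥ (v (z.1, θ)).ofLp)) := by
  set w := pull (n := n) (μ := (rect a b).prod (ivl a b)) (fun z => (z.1.1, z.2)) (by fun_prop)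
    (mass a b) (map_lift a b) v with hw
  set y := mulOp (fun z : (ℝ × ℝ) × ℝ => R.ker (z.1.2, z.2)) R.memLp_ker_lift w with hy
  set R0 := mulOp (fun z : ℝ × ℝ => R.R0 z.2)
    (fun i j => (R.memLp_R0 i j).comp_snd (ivl 0 1)) with hR0
  have e0 : R.lift v = R0 v + intOp (rect a b) (ivl a b) y := rfl
  rw [e0]
  have hx : ∀ᵐ z ∂(rect a b), z.2 ∈ Icc a b :=
    Measure.quasiMeasurePreserving_snd.ae (ae_restrict_mem measurableSet_Icc)
  filter_upwards [Lp.coeFn_add (R0 v) (intOp (rect a b) (ivl a b) y),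
    mulOp_apply (fun z : ℝ × ℝ => R.R0 z.2)
      (fun i j => (R.memLp_R0 i j).comp_snd (ivl 0 1)) v, intOp_apply y, integrable_slice y,
    Measure.ae_ae_of_ae_prod (mulOp_apply _ R.memLp_ker_lift w),
    Measure.ae_ae_of_ae_prod
      (pull_apply (fun z : (ℝ × ℝ) × ℝ => (z.1.1, z.2)) (by fun_prop) (mass a b)
        (map_lift a b) v), hx] with z h1 h2 h3 h4 h5 h6 hx
  have h7 : (fun θ => y (z, θ)) =ᵐ[ivl a b]
      fun θ => WithLp.toLp 2 (R.ker (z.2, θ) *ᵥ (v (z.1, θ)).ofLp) := by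
    filter_upwards [h5, h6] with θ h8 h9
    rw [hy, h8, hw, h9]
  rw [h1, Pi.add_apply, hR0, h2, h3, integral_congr_ae h7,
    R.integral_ker (v := fun θ => v (z.1, θ)) hx (h4.congr h7)]

end ThreePI

theorem memLp_step (n : ℕ) (a b : ℝ) (i j : Fin n) :
    MemLp (fun z : (ℝ × ℝ) × ℝ =>
      (if z.2 ≤ z.1.1 then (1 : Matrix (Fin n) (Fin n) ℝ) else 0) i j) ⊤
      ((rect a b).prod (ivl 0 1)) := by
  refine memLp_top_of_bound (C := 1) ?_ (ae_of_all _ fun z => ?_)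
  · have hs : MeasurableSet {z : (ℝ × ℝ) × ℝ | z.2 ≤ z.1.1} :=
      measurableSet_le measurable_snd (measurable_fst.comp measurable_fst)
    have : (fun z : (ℝ × ℝ) × ℝ =>
        (if z.2 ≤ z.1.1 then (1 : Matrix (Fin n) (Fin n) ℝ) else 0) i j) =
        {z : (ℝ × ℝ) × ℝ | z.2 ≤ z.1.1}.indicator
          (fun _ => (1 : Matrix (Fin n) (Fin n) ℝ) i j) := by
      funext z
      by_cases h : z.2 ≤ z.1.1 <;> simp [h]
    rw [this]
    exact (measurable_const.indicator hs).aestronglyMeasurable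
  · by_cases h : z.2 ≤ z.1.1 <;> by_cases h' : i = j <;> simp [h, h', Matrix.one_apply]

/-- `(volterra v)(s, x) = ∫₀ˢ v(ν, x) dν`; see `volterra_apply`. -/
def volterra (n : ℕ) (a b : ℝ) : L2R n a b →L[ℝ] L2R n a b :=
  intOp (rect a b) (ivl 0 1) ∘L
    mulOp (fun z => if z.2 ≤ z.1.1 then 1 else 0) (memLp_step n a b) ∘L
    pull (fun z => (z.2, z.1.2)) (by fun_prop) (mass 0 1) (map_volterra a b)

theorem volterra_apply (v : L2R n a b) :
    ∀ᵐ z ∂(rect a b), volterra n a b v z = ∫ ν in (0 : ℝ)..z.1, v (ν, z.2) := by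
  have hx : ∀ᵐ z ∂(rect a b), z.1 ∈ Icc (0 : ℝ) 1 :=
    Measure.quasiMeasurePreserving_fst.ae (ae_restrict_mem measurableSet_Icc)
  set w := pull (n := n) (μ := (rect a b).prod (ivl 0 1)) (fun z => (z.2, z.1.2)) (by fun_prop)
    (mass 0 1) (map_volterra a b) v with hw
  set y := mulOp _ (memLp_step n a b) w with hy
  have e0 : volterra n a b v = intOp (rect a b) (ivl 0 1) y := rfl
  rw [e0]
  filter_upwards [intOp_apply y, Measure.ae_ae_of_ae_prod (mulOp_apply _ (memLp_step n a b) w),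
    Measure.ae_ae_of_ae_prod
      (pull_apply (fun z : (ℝ × ℝ) × ℝ => (z.2, z.1.2)) (by fun_prop) (mass 0 1)
        (map_volterra a b) v), hx] with z h3 h5 h6 hx
  rw [h3]
  have h7 : (fun ν => y (z, ν)) =ᵐ[ivl 0 1] (Iic z.1).indicator (fun ν => v (ν, z.2)) := by
    filter_upwards [h5, h6] with ν h8 h9
    rw [hy, h8, hw, h9]
    by_cases h : ν ≤ z.1 <;> simp [h]
  rw [integral_congr_ae h7, integral_indicator measurableSet_Iic,
    intervalIntegral.integral_of_le hx.1, ← integral_Icc_eq_integral_Ioc,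
    Measure.restrict_restrict measurableSet_Iic]
  congr 2
  ext ν
  simp only [mem_inter_iff, mem_Iic, mem_Icc]
  exact ⟨fun h => ⟨h.2.1, h.1⟩, fun h => ⟨h.2, h.1, h.2.trans hx.2⟩⟩

/-- `(integrateS v)(x) = ∫₀¹ v(s, x) ds`; see `integrateS_apply`. -/
def integrateS (n : ℕ) (a b : ℝ) : L2R n a b →L[ℝ] L2 n a b :=
  intOp (ivl a b) (ivl 0 1) ∘L pull Prod.swap measurable_swap 1 (map_swap a b)

theorem integrateS_apply (v : L2R n a b) :
    ∀ᵐ x ∂(ivl a b), integrateS n a b v x = ∫ s in (0 : ℝ)..1, v (s, x) := by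
  filter_upwards [intOp_apply (pull Prod.swap measurable_swap 1 (map_swap a b) v),
    Measure.ae_ae_of_ae_prod (pull_apply Prod.swap measurable_swap 1 (map_swap a b) v)]
    with x h1 h2
  refine h1.trans ?_
  rw [integral_congr_ae h2, intervalIntegral.integral_of_le zero_le_one,
    ← integral_Icc_eq_integral_Ioc]
  rfl

/-- `(constS v)(s, x) = v(x)`; see `constS_apply`. -/
def constS (n : ℕ) (a b : ℝ) : L2 n a b →L[ℝ] L2R n a b :=
  pull Prod.snd measurable_snd (mass 0 1) (map_const a b)

theorem constS_apply (v : L2 n a b) :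
    ∀ᵐ z ∂(rect a b), constS n a b v z = v z.2 :=
  pull_apply Prod.snd measurable_snd (mass 0 1) (map_const a b) v

/-- The operator `[T₁₁ T₁₂; T₂₁ T₂₂]` on `L₂ⁿ[a, b] × L₂ⁿ([0, 1] × [a, b])`. -/
def blockOp (T11 : L2 n a b →L[ℝ] L2 n a b) (T12 : L2R n a b →L[ℝ] L2 n a b)
    (T21 : L2 n a b →L[ℝ] L2R n a b) (T22 : L2R n a b →L[ℝ] L2R n a b) :
    Z n a b →L[ℝ] Z n a b :=
  (WithLp.prodContinuousLinearEquiv 2 ℝ (L2 n a b) (L2R n a b)).symm.toContinuousLinearMap ∘L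
    ((T11.coprod T12).prod (T21.coprod T22)) ∘L
      (WithLp.prodContinuousLinearEquiv 2 ℝ (L2 n a b) (L2R n a b)).toContinuousLinearMap

end PI

/-! ### Sobolev spaces and traces -/

section Sobolev

variable {n : ℕ} {a b : ℝ}

/-- `g` is the weak derivative `∂ₓᵏ u` on `(a, b)`. -/
def HasWeakDeriv (k : ℕ) (u g : L2 n a b) : Prop :=
  ∀ η : ℝ → ℝ, ContDiff ℝ ∞ η → HasCompactSupport η → tsupport η ⊆ Ioo a b →
    ∫ x, iteratedDeriv k η x • u x ∂(ivl a b) = (-1 : ℝ) ^ k • ∫ x, η x • g x ∂(ivl a b)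

/-- The Sobolev space `H_kⁿ[a, b]`. -/
def SobolevH (n : ℕ) (a b : ℝ) (k : ℕ) : Set (L2 n a b) :=
  {u | ∀ i ≤ k, ∃ g, HasWeakDeriv i u g}

/-- The weak derivative `∂ₓᵏ u` (an arbitrary value if it does not exist in `L₂`). -/
def weakDeriv (k : ℕ) (u : L2 n a b) : L2 n a b :=
  Classical.epsilon fun g => HasWeakDeriv k u g

/-- The value `u(x)`, `x ∈ [a, b]`, of the continuous representative of `u` (which is unique if
`a < b`; an arbitrary value if there is none). -/
def pointValue (u : L2 n a b) (x : ℝ) : Vec n :=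
  Classical.epsilon (fun f : ℝ → Vec n =>
    ContinuousOn f (Icc a b) ∧ ∀ᵐ y ∂(ivl a b), u y = f y) x

/-- The classical derivative `∂ₛⁱ ∂ₓʲ η` of a function on the plane. -/
def mixedDeriv (i j : ℕ) (η : ℝ × ℝ → ℝ) (z : ℝ × ℝ) : ℝ :=
  iteratedDeriv i (fun s => iteratedDeriv j (fun x => η (s, x)) z.2) z.1

/-- `g` is the weak derivative `∂ₛⁱ ∂ₓʲ φ` on `(0, 1) × (a, b)`. -/
def HasWeakDerivR (i j : ℕ) (φ g : L2R n a b) : Prop :=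
  ∀ η : ℝ × ℝ → ℝ, ContDiff ℝ ∞ η → HasCompactSupport η →
    tsupport η ⊆ Ioo 0 1 ×ˢ Ioo a b →
      ∫ z, mixedDeriv i j η z • φ z ∂(rect a b) =
        (-1 : ℝ) ^ (i + j) • ∫ z, η z • g z ∂(rect a b)

/-- The Sobolev space `H_{(k, l)}ⁿ([0, 1] × [a, b])`: all mixed weak derivatives of order at most
`k` in `s` and at most `l` in `x` are in `L₂`. -/
def SobolevHR (n : ℕ) (a b : ℝ) (k l : ℕ) : Set (L2R n a b) :=
  {φ | ∀ i ≤ k, ∀ j ≤ l, ∃ g, HasWeakDerivR i j φ g}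

/-- The weak derivative `∂ₛⁱ ∂ₓʲ φ` (an arbitrary value if it does not exist in `L₂`). -/
def weakDerivR (i j : ℕ) (φ : L2R n a b) : L2R n a b :=
  Classical.epsilon fun g => HasWeakDerivR i j φ g

/-- The slice `φ(s, ·) ∈ L₂ⁿ[a, b]` at `s ∈ [0, 1]`, taken from the representative
`Φ : [0, 1] → L₂ⁿ[a, b]` of `φ` that is continuous in `s` (which is unique; an arbitrary value
if there is none). -/
def slice (φ : L2R n a b) (s : ℝ) : L2 n a b :=
  Classical.epsilon (fun Φ : ℝ → L2 n a b =>
    ContinuousOn Φ (Icc 0 1) ∧ ∀ᵐ r ∂(ivl 0 1), ∀ᵐ x ∂(ivl a b), φ (r, x) = Φ r x) s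

end Sobolev

/-! ### The delayed PDE -/

/-- Stacking `k` vectors of `ℝⁿ` into one vector of `ℝᵏⁿ`. -/
def stack {n k : ℕ} (v : Fin k → Vec n) : Fin k × Fin n → ℝ := fun p => v p.1 p.2

/-- Stacking `k` matrices of size `n × m` into one matrix of size `kn × m`. -/
def stackMat {n k m : ℕ} (M : Fin k → Matrix (Fin n) (Fin m) ℝ) :
    Matrix (Fin k × Fin n) (Fin m) ℝ := Matrix.of fun p j => M p.1 p.2 j

/-- Data `{A, A_d, B, τ}` of a delayed PDE on `[a, b]`:
`u_t(t) = A [u; u_x; u_xx](t) + A_d [u; u_x; u_xx](t - τ)`, with boundary conditions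
`B [u(a); u_x(a); u(b); u_x(b)] = 0`. -/
structure DPDE (n : ℕ) where
  a : ℝ
  b : ℝ
  hab : a < b
  τ : ℝ
  hτ : 0 < τ
  A : ℝ → Matrix (Fin n) (Fin 3 × Fin n) ℝ
  Ad : ℝ → Matrix (Fin n) (Fin 3 × Fin n) ℝ
  hA : ∀ i j, MemLp (fun x => A x i j) ⊤ (ivl a b)
  hAd : ∀ i j, MemLp (fun x => Ad x i j) ⊤ (ivl a b)
  B : Matrix (Fin 2 × Fin n) (Fin 4 × Fin n) ℝ

namespace DPDE

variable {n : ℕ} (D : DPDE n)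

/-- The domain `X_B`. -/
def XB : Set (L2 n D.a D.b) :=
  {u | u ∈ SobolevH n D.a D.b 2 ∧
    D.B *ᵥ stack ![pointValue u D.a, pointValue (weakDeriv 1 u) D.a,
      pointValue u D.b, pointValue (weakDeriv 1 u) D.b] = 0}

/-- The domain `Y_u` of the delayed state. -/
def Y (u : L2 n D.a D.b) : Set (L2R n D.a D.b) :=
  {φ | φ ∈ SobolevHR n D.a D.b 1 2 ∧ slice φ 0 = u ∧ ∀ s ∈ Icc (0 : ℝ) 1, slice φ s ∈ D.XB}

/-- The vector `[u; u_x; u_xx](x)`. -/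
def jet (u : L2 n D.a D.b) (x : ℝ) : Fin 3 × Fin n → ℝ :=
  stack ![u x, weakDeriv 1 u x, weakDeriv 2 u x]

/-- `(u, φ)` is a solution of the delayed PDE with initial state `(u₀, φ₀)`: it is differentiable
in time with values in `L₂`, and for all `t ≥ 0` one has `u(t) ∈ X_B`, `φ(t) ∈ Y_{u(t)}`,
`u_t = A [u; u_x; u_xx] + A_d [φ; φ_x; φ_xx](s = 1)` and `φ_t = -(1/τ) φ_s`. -/
structure IsSolution (u₀ : L2 n D.a D.b) (φ₀ : L2R n D.a D.b)
    (u : ℝ → L2 n D.a D.b) (φ : ℝ → L2R n D.a D.b) : Prop where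
  init_u : u 0 = u₀
  init_φ : φ 0 = φ₀
  mem_XB : ∀ t ≥ 0, u t ∈ D.XB
  mem_Y : ∀ t ≥ 0, φ t ∈ D.Y (u t)
  deriv_u : ∀ t ≥ 0, ∃ u' : L2 n D.a D.b, HasDerivWithinAt u u' (Ici 0) t ∧
    ∀ᵐ x ∂(ivl D.a D.b), u' x =
      WithLp.toLp 2 (D.A x *ᵥ D.jet (u t) x + D.Ad x *ᵥ D.jet (slice (φ t) 1) x)
  deriv_φ : ∀ t ≥ 0,
    HasDerivWithinAt φ (-(1 / D.τ) • weakDerivR 1 0 (φ t)) (Ici 0) t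

/-! ### The operators `𝒯` and `𝒜` -/

/-- `H`, for which `[u(a); u_x(a); u(b); u_x(b)] = H [u(a); u_x(a)] + ∫ Q(θ) u_xx(θ) dθ`. -/
def H : Matrix (Fin 4 × Fin n) (Fin 2 × Fin n) ℝ :=
  Matrix.of fun p q => !![1, 0; 0, 1; 1, D.b - D.a; 0, 1] p.1 q.1 *
    (1 : Matrix (Fin n) (Fin n) ℝ) p.2 q.2

/-- `Q(θ) = [0; 0; (b - θ) I; I]`. -/
def Q (θ : ℝ) : Matrix (Fin 4 × Fin n) (Fin n) ℝ :=
  stackMat ![0, 0, (D.b - θ) • 1, 1]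

/-- `K(x) = [I, (x - a) I]`. -/
def K (x : ℝ) : Matrix (Fin n) (Fin 2 × Fin n) ℝ :=
  Matrix.of fun i q => ![1, x - D.a] q.1 * (1 : Matrix (Fin n) (Fin n) ℝ) i q.2

/-- `T₂(x, θ) = -K(x) (BH)⁻¹ B Q(θ)`. -/
def T2 (x θ : ℝ) : Matrix (Fin n) (Fin n) ℝ :=
  -(D.K x * ((D.B * D.H)⁻¹ * (D.B * D.Q θ)))

/-- `T₁(x, θ) = (x - θ) I + T₂(x, θ)`. -/
def T1 (x θ : ℝ) : Matrix (Fin n) (Fin n) ℝ := (x - θ) • 1 + D.T2 x θ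

/-- The entrywise partial derivative `∂ₓ T(x, θ)` of a matrix-valued kernel. -/
def partialX (T : ℝ → ℝ → Matrix (Fin n) (Fin n) ℝ) (x θ : ℝ) : Matrix (Fin n) (Fin n) ℝ :=
  Matrix.of fun i j => deriv (fun y => T y θ i j) x

theorem memLp_of_continuous {a b : ℝ} {f : ℝ × ℝ → ℝ} (hf : Continuous f) :
    MemLp f ⊤ ((ivl a b).prod (ivl a b)) := by
  obtain ⟨C, hC⟩ := (isCompact_Icc (a := a) (b := b)).prod (isCompact_Icc (a := a) (b := b))
    |>.exists_bound_of_continuousOn hf.continuousOn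
  refine memLp_top_of_bound hf.aestronglyMeasurable C ?_
  rw [Measure.prod_restrict]
  exact (ae_restrict_mem (measurableSet_Icc.prod measurableSet_Icc)).mono hC

theorem continuous_Q : Continuous D.Q := by
  refine continuous_matrix fun p j => ?_
  obtain ⟨k, i⟩ := p
  fin_cases k
  · exact continuous_const
  · exact continuous_const
  · change Continuous fun θ => (D.b - θ) * (1 : Matrix (Fin n) (Fin n) ℝ) i j
    fun_prop
  · exact continuous_const

/-- `T₂` is affine in `x` with coefficients continuous in `θ`. -/
theorem exists_T2 (i j : Fin n) : ∃ c d : ℝ → ℝ, Continuous c ∧ Continuous d ∧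
    ∀ x θ, D.T2 x θ i j = c θ + (x - D.a) * d θ := by
  let M : ℝ → Matrix (Fin 2 × Fin n) (Fin n) ℝ := fun θ => (D.B * D.H)⁻¹ * (D.B * D.Q θ)
  have hM : Continuous M :=
    continuous_const.matrix_mul (continuous_const.matrix_mul D.continuous_Q)
  refine ⟨fun θ => -M θ (0, i) j, fun θ => -M θ (1, i) j, (hM.matrix_elem _ _).neg,
    (hM.matrix_elem _ _).neg, fun x θ => ?_⟩
  change -(D.K x * M θ) i j = _
  rw [Matrix.mul_apply, Fintype.sum_prod_type, Fin.sum_univ_two]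
  simp [K, Matrix.one_apply]
  ring

theorem exists_T1 (i j : Fin n) : ∃ c d : ℝ → ℝ, Continuous c ∧ Continuous d ∧
    ∀ x θ, D.T1 x θ i j = c θ + (x - D.a) * d θ := by
  obtain ⟨c, d, hc, hd, h⟩ := D.exists_T2 i j
  refine ⟨fun θ => (D.a - θ) * (1 : Matrix (Fin n) (Fin n) ℝ) i j + c θ,
    fun θ => (1 : Matrix (Fin n) (Fin n) ℝ) i j + d θ, by fun_prop, by fun_prop, fun x θ => ?_⟩
  rw [T1, Matrix.add_apply, Matrix.smul_apply, h, smul_eq_mul]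
  ring

/-- Kernels that are affine in `x` with continuous coefficients. -/
def IsAffine (T : ℝ → ℝ → Matrix (Fin n) (Fin n) ℝ) : Prop :=
  ∀ i j, ∃ c d : ℝ → ℝ, Continuous c ∧ Continuous d ∧
    ∀ x θ, T x θ i j = c θ + (x - D.a) * d θ

theorem IsAffine.memLp {D : DPDE n} {T : ℝ → ℝ → Matrix (Fin n) (Fin n) ℝ} (hT : D.IsAffine T)
    (i j : Fin n) :
    MemLp (fun z : ℝ × ℝ => T z.1 z.2 i j) ⊤ ((ivl D.a D.b).prod (ivl D.a D.b)) := by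
  obtain ⟨c, d, hc, hd, h⟩ := hT i j
  refine memLp_of_continuous ?_
  simp only [h]
  fun_prop

theorem IsAffine.memLp_partialX {D : DPDE n} {T : ℝ → ℝ → Matrix (Fin n) (Fin n) ℝ}
    (hT : D.IsAffine T) (i j : Fin n) :
    MemLp (fun z : ℝ × ℝ => partialX T z.1 z.2 i j) ⊤ ((ivl D.a D.b).prod (ivl D.a D.b)) := by
  obtain ⟨c, d, hc, hd, h⟩ := hT i j
  refine memLp_of_continuous ?_
  have : (fun z : ℝ × ℝ => partialX T z.1 z.2 i j) = fun z => d z.2 := by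
    funext z
    simp [partialX, h]
  rw [this]
  fun_prop

/-- The kernel `C(x) [T(x, θ); ∂ₓT(x, θ); 0]`. -/
def dynKer (C : ℝ → Matrix (Fin n) (Fin 3 × Fin n) ℝ)
    (T : ℝ → ℝ → Matrix (Fin n) (Fin n) ℝ) (x θ : ℝ) : Matrix (Fin n) (Fin n) ℝ :=
  C x * (stackMat ![T x θ, partialX T x θ, 0] : Matrix (Fin 3 × Fin n) (Fin n) ℝ)

theorem memLp_dynKer {C : ℝ → Matrix (Fin n) (Fin 3 × Fin n) ℝ}
    (hC : ∀ i j, MemLp (fun x => C x i j) ⊤ (ivl D.a D.b))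
    {T : ℝ → ℝ → Matrix (Fin n) (Fin n) ℝ} (hT : D.IsAffine T) (i j : Fin n) :
    MemLp (fun z : ℝ × ℝ => dynKer C T z.1 z.2 i j) ⊤
      ((ivl D.a D.b).prod (ivl D.a D.b)) := by
  simp only [dynKer, Matrix.mul_apply]
  refine memLp_finsetSum _ fun p _ => ?_
  refine MemLp.mul' (p := ⊤) (q := ⊤) (r := ⊤) ?_ ((hC i p).comp_fst (ivl D.a D.b))
  obtain ⟨k, l⟩ := p
  fin_cases k
  · exact hT.memLp l j
  · exact hT.memLp_partialX l j
  · exact memLp_top_const (0 : ℝ)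

/-- The 3-PI parameters `{C [0; 0; I], C [T₁; ∂ₓT₁; 0], C [T₂; ∂ₓT₂; 0]}`. -/
def dynParams (C : ℝ → Matrix (Fin n) (Fin 3 × Fin n) ℝ)
    (hC : ∀ i j, MemLp (fun x => C x i j) ⊤ (ivl D.a D.b)) : ThreePI n D.a D.b where
  R0 x := C x * (stackMat ![0, 0, 1] : Matrix (Fin 3 × Fin n) (Fin n) ℝ)
  R1 := dynKer C D.T1
  R2 := dynKer C D.T2
  memLp_R0 i j := by
    simp only [Matrix.mul_apply]
    exact memLp_finsetSum _ fun p _ =>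
      MemLp.mul' (p := ⊤) (q := ⊤) (r := ⊤) (memLp_top_const _) (hC i p)
  memLp_R1 := D.memLp_dynKer hC D.exists_T1
  memLp_R2 := D.memLp_dynKer hC D.exists_T2

/-- The 3-PI parameters `{0, T₁, T₂}` of `𝒯₁`. -/
def paramsT : ThreePI n D.a D.b where
  R0 _ := 0
  R1 := D.T1
  R2 := D.T2
  memLp_R0 _ _ := memLp_top_const (0 : ℝ)
  memLp_R1 := IsAffine.memLp D.exists_T1
  memLp_R2 := IsAffine.memLp D.exists_T2

/-- The 3-PI parameters of `𝒜₁₁`. -/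
def paramsA : ThreePI n D.a D.b := D.dynParams D.A D.hA

/-- The 3-PI parameters of `𝒜₁₁,d`. -/
def paramsAd : ThreePI n D.a D.b := D.dynParams D.Ad D.hAd

/-- `𝒯 = [𝒯₁ 0; 𝒯₁ 𝒯₂]` with `(𝒯₂ v)(s) = ∫₀ˢ 𝒯₁ v(θ) dθ`. -/
def opT : Z n D.a D.b →L[ℝ] Z n D.a D.b :=
  blockOp D.paramsT.op 0
    (constS n D.a D.b ∘L D.paramsT.op) (volterra n D.a D.b ∘L D.paramsT.lift)

/-- `𝒜 = [𝒜₁₁ + 𝒜₁₁,d  𝒜₁₂; 0  𝒜₂₂]` with `𝒜₁₂ v = ∫₀¹ 𝒜₁₁,d v(s) ds` and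
`(𝒜₂₂ v)(s) = -(1/τ) 𝒯₁ v(s)`. -/
def opA : Z n D.a D.b →L[ℝ] Z n D.a D.b :=
  blockOp (D.paramsA.op + D.paramsAd.op) (integrateS n D.a D.b ∘L D.paramsAd.lift)
    0 (-(1 / D.τ) • D.paramsT.lift)

end DPDE

end DelayPDE

end

/-! The idea is to trade the boundary-value problem for an equation without boundary conditions. At
each time the state has the form `𝒯 z` and its time derivative is `𝒜 z`, where `z = (u_xx, ∂ₛ∂ₓ²φ)`.
The operator inequality, tested at `z`, is then the dissipation inequality for `V = ⟨𝒫(u, φ), (u,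
φ)⟩`: one has `V' = 2⟨𝒫𝒯z, 𝒜z⟩ ≤ -2α⟨𝒫𝒯z, 𝒯z⟩ = -2αV`. Hence `exp(2αt) V` does not increase, and
`ε²‖x‖² ≤ V ≤ ‖𝒫‖‖x‖²` gives the bound (`norm_le_of_lyapunov`). Only a pointwise choice of `z` is
needed, with no regularity in time.

The representation rests on two facts. On `X_B`, Taylor's formula expresses `u` and `u_x` through
`u(a)`, `u_x(a)` and `u_xx`. The boundary conditions become a linear system with matrix `BH` for the
traces at `a`, with right-hand side given by two moments of `u_xx`, so `𝒯₁ u_xx = u`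
(`opT1_weakDeriv`) and `𝒫_C u_xx = C[u; u_x; u_xx]` (`dynParams_op_weakDeriv`).

For the delayed state, `φ_xx` is a primitive in `s` of `ψ = ∂ₛ∂ₓ²φ`, say `φ_xx = c + ∫₀ˢ ψ`. Almost
every slice gives `𝒯₁ φ_xx(s) = φ(s)`, and `𝒯₁` commutes with integration in `s`, so `φ = 𝒯₁c + ∫₀ˢ
𝒯₁ψ`. Uniqueness of such a decomposition identifies `𝒯₁c = u` and `𝒯₁ψ = φₛ`; applying `∂ₓ²` at `s =
1` gives `φ_xx(1) = u_xx + ∫₀¹ ψ` (`exists_of_mem_Y`). Substituting these into the PDE gives `𝒜 z`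
(`IsSolution.exists_state`).

Weak derivatives enter only through product test functions, which suffice to determine integrable
functions on a rectangle. -/

noncomputable section

namespace DelayPDE

/-! ### Test functions and weak derivatives on intervals and rectangles -/

section TestFunctions

variable {E : Type*} [NormedAddCommGroup E] [NormedSpace ℝ E] {p q r t : ℝ}

/-- `η` is a test function on `(p, q)`. -/
structure IsTest (p q : ℝ) (η : ℝ → ℝ) : Prop where
  contDiff : ContDiff ℝ ∞ η
  hasCompactSupport : HasCompactSupport η
  tsupport_subset : tsupport η ⊆ Ioo p q

namespace IsTest

variable {η ζ : ℝ → ℝ}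

theorem continuous (h : IsTest p q η) : Continuous η := h.contDiff.continuous

theorem deriv (h : IsTest p q η) : IsTest p q (deriv η) :=
  ⟨(contDiff_infty_iff_deriv.1 h.contDiff).2, h.hasCompactSupport.deriv,
    (tsupport_deriv_subset (𝕜 := ℝ) (f := η)).trans h.tsupport_subset⟩

theorem eq_zero (h : IsTest p q η) {s : ℝ} (hs : s ∉ Ioo p q) : η s = 0 :=
  image_eq_zero_of_notMem_tsupport fun h' => hs (h.tsupport_subset h')

theorem left (h : IsTest p q η) : η p = 0 := h.eq_zero (by simp)

theorem right (h : IsTest p q η) : η q = 0 := h.eq_zero (by simp)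

theorem exists_bound (h : IsTest p q η) : ∃ C, ∀ s, ‖η s‖ ≤ C :=
  h.hasCompactSupport.exists_bound_of_continuous h.continuous

theorem integrable_smul (h : IsTest p q η) {μ : Measure ℝ} {f : ℝ → E} (hf : Integrable f μ) :
    Integrable (fun s => η s • f s) μ := by
  obtain ⟨C, hC⟩ := h.exists_bound
  exact hf.bdd_smul C h.continuous.aestronglyMeasurable (ae_of_all _ hC)

theorem integrable_mul_smul (hη : IsTest p q η) (hζ : IsTest r t ζ) {μ : Measure (ℝ × ℝ)}
    {f : ℝ × ℝ → E} (hf : Integrable f μ) :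
    Integrable (fun z => (η z.1 * ζ z.2) • f z) μ := by
  obtain ⟨C, hC⟩ := hη.exists_bound
  obtain ⟨C', hC'⟩ := hζ.exists_bound
  refine hf.bdd_smul (C * C') ?_ (ae_of_all _ fun z => ?_)
  · exact ((hη.continuous.comp continuous_fst).mul
      (hζ.continuous.comp continuous_snd)).aestronglyMeasurable
  · rw [norm_mul]
    exact mul_le_mul (hC _) (hC' _) (norm_nonneg _) ((norm_nonneg _).trans (hC 0))

theorem intervalIntegral_deriv (h : IsTest p q η) (s : ℝ) :
    ∫ x in s..q, _root_.deriv η x = -η s := by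
  rw [intervalIntegral.integral_deriv_eq_sub, h.right, zero_sub]
  · exact fun x _ => (h.contDiff.differentiable (by simp)).differentiableAt
  · exact (h.deriv.continuous).intervalIntegrable _ _

/-- A test function with mean zero has a primitive that is a test function. -/
theorem exists_primitive (h : IsTest p q η) (h0 : ∫ s in p..q, η s = 0) :
    ∃ F, IsTest p q F ∧ _root_.deriv F = η := by
  have hd : _root_.deriv (fun s => ∫ x in p..s, η x) = η := by
    funext s
    exact (h.continuous.integral_hasStrictDerivAt p s).hasDerivAt.deriv
  have hdiff : Differentiable ℝ (fun s => ∫ x in p..s, η x) := fun s =>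
    (h.continuous.integral_hasStrictDerivAt p s).hasDerivAt.differentiableAt
  have hK : IsCompact (tsupport η) := h.hasCompactSupport
  -- The support lies in a compact interval strictly inside `(p, q)`. Left of it the primitive is
  -- zero because the integrand is; right of it, because the total mean is zero.
  have hsupp : ∃ p' q', p < p' ∧ q' < q ∧ tsupport η ⊆ Icc p' q' := by
    rcases (tsupport η).eq_empty_or_nonempty with he | hne
    · exact ⟨p + 1, q - 1, by simp, by simp, by simp [he]⟩
    · refine ⟨sInf (tsupport η), sSup (tsupport η), ?_, ?_, fun x hx =>
        ⟨csInf_le hK.bddBelow hx, le_csSup hK.bddAbove hx⟩⟩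
      · exact (h.tsupport_subset (hK.sInf_mem hne)).1
      · exact (h.tsupport_subset (hK.sSup_mem hne)).2
  obtain ⟨p', q', hp, hq, hsub⟩ := hsupp
  have hz : ∀ x, x ∉ Icc p' q' → η x = 0 := fun x hx =>
    image_eq_zero_of_notMem_tsupport fun h' => hx (hsub h')
  have hts : tsupport (fun s => ∫ x in p..s, η x) ⊆ Icc p' q' := by
    refine closure_minimal (fun s hs => ?_) isClosed_Icc
    by_contra hns
    refine hs ?_
    rw [mem_Icc, not_and_or, not_le, not_le] at hns
    rcases hns with hs' | hs'
    · refine (intervalIntegral.integral_congr (g := fun _ => (0 : ℝ)) fun x hx => ?_).trans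
        (by simp)
      refine hz x fun hx' => ?_
      have := (mem_uIcc.1 hx)
      rcases this with h1 | h1 <;> linarith [h1.1, h1.2, hx'.1]
    · change ∫ x in p..s, η x = 0
      rw [← intervalIntegral.integral_add_adjacent_intervals
        (h.continuous.intervalIntegrable p q) (h.continuous.intervalIntegrable q s), h0, zero_add]
      refine (intervalIntegral.integral_congr (g := fun _ => (0 : ℝ)) fun x hx => ?_).trans
        (by simp)
      refine hz x fun hx' => ?_
      have := (mem_uIcc.1 hx)
      rcases this with h1 | h1 <;> linarith [h1.1, h1.2, hx'.2]
  refine ⟨fun s => ∫ x in p..s, η x, ⟨?_, ?_, ?_⟩, hd⟩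
  · rw [contDiff_infty_iff_deriv, hd]
    exact ⟨hdiff, h.contDiff⟩
  · exact isCompact_Icc.of_isClosed_subset (isClosed_tsupport _) hts
  · exact hts.trans (Icc_subset_Ioo hp hq)

/-- Used with `ζ` of mass one and `c = ∫ η`: the difference has mean zero, hence is the derivative
of a test function. -/
theorem sub_smul (hη : IsTest p q η) (hζ : IsTest p q ζ) (c : ℝ) :
    IsTest p q (fun s => η s - c * ζ s) := by
  have h2 : tsupport (fun s => η s - c * ζ s) ⊆ tsupport η ∪ tsupport ζ := by
    refine closure_minimal (fun s hs => ?_) ((isClosed_tsupport _).union (isClosed_tsupport _))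
    by_contra hn
    rw [mem_union, not_or] at hn
    apply hs
    simp [image_eq_zero_of_notMem_tsupport hn.1, image_eq_zero_of_notMem_tsupport hn.2]
  refine ⟨hη.contDiff.sub (contDiff_const.mul hζ.contDiff), ?_,
    h2.trans (union_subset hη.tsupport_subset hζ.tsupport_subset)⟩
  exact IsCompact.of_isClosed_subset (hη.hasCompactSupport.isCompact.union
    hζ.hasCompactSupport.isCompact) (isClosed_tsupport _) h2

end IsTest

theorem exists_test_integral_eq_one (hpq : p < q) :
    ∃ ρ, IsTest p q ρ ∧ ∫ s in p..q, ρ s = 1 := by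
  have hc : 0 < (q - p) / 4 := by linarith
  let f : ContDiffBump ((p + q) / 2) := ⟨(q - p) / 8, (q - p) / 4, by linarith, by linarith⟩
  have hts : tsupport (f.normed volume) ⊆ Ioo p q := by
    rw [f.tsupport_normed_eq]
    intro x hx
    rw [Metric.mem_closedBall, Real.dist_eq, abs_le] at hx
    change _ ≤ _ ∧ _ ≤ (q - p) / 4 at hx
    change -((q - p) / 4) ≤ _ ∧ _ at hx
    constructor <;> linarith [hx.1, hx.2]
  refine ⟨f.normed volume, ⟨f.contDiff_normed, f.hasCompactSupport_normed, hts⟩, ?_⟩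
  rw [intervalIntegral.integral_of_le hpq.le, ← f.integral_normed (μ := volume)]
  refine setIntegral_eq_integral_of_forall_compl_eq_zero fun x hx => ?_
  exact image_eq_zero_of_notMem_tsupport fun h => hx (Ioo_subset_Ioc_self (hts h))

theorem integral_ivl (hpq : p ≤ q) (f : ℝ → E) : ∫ s, f s ∂(ivl p q) = ∫ s in p..q, f s := by
  rw [integral_Icc_eq_integral_Ioc, intervalIntegral.integral_of_le hpq]

theorem ae_mem_ivl (p q : ℝ) : ∀ᵐ s ∂(ivl p q), s ∈ Icc p q := ae_restrict_mem measurableSet_Icc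

theorem integral_indicator_Iic_ivl {s : ℝ} (hs : s ∈ Icc p q) (g : ℝ → E) :
    ∫ σ, (Iic s).indicator g σ ∂(ivl p q) = ∫ σ in p..s, g σ := by
  rw [integral_indicator measurableSet_Iic, Measure.restrict_restrict measurableSet_Iic,
    intervalIntegral.integral_of_le hs.1, ← integral_Icc_eq_integral_Ioc]
  congr 2
  ext σ
  simp only [mem_inter_iff, mem_Iic, mem_Icc]
  exact ⟨fun h => ⟨h.2.1, h.1⟩, fun h => ⟨h.2, h.1, h.2.trans hs.2⟩⟩

theorem continuousOn_primitive_ivl {g : ℝ → E} (hg : Integrable g (ivl p q)) :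
    ContinuousOn (fun s => ∫ σ in p..s, g σ) (Icc p q) :=
  (intervalIntegral.continuousOn_primitive hg).congr fun _ hs =>
    intervalIntegral.integral_of_le hs.1

theorem integrable_primitive {g : ℝ → E} (hg : Integrable g (ivl p q)) :
    Integrable (fun s => ∫ σ in p..s, g σ) (ivl p q) :=
  (continuousOn_primitive_ivl hg).integrableOn_Icc

/-- Fubini in a third variable `σ`, for `g(σ, x)` cut off to `σ ≤ s`. The map `((s, x), σ) ↦ (σ, x)`
pushes the triple product measure to a finite multiple of the original one, so integrability
transfers. -/
theorem integrable_primitive_prod {g : ℝ × ℝ → E}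
    (hg : Integrable g ((ivl p q).prod (ivl r t))) :
    Integrable (fun z : ℝ × ℝ => ∫ σ in p..z.1, g (σ, z.2)) ((ivl p q).prod (ivl r t)) := by
  have hmap : (((ivl p q).prod (ivl r t)).prod (ivl p q)).map (fun z => (z.2, z.1.2)) =
      ivl p q univ • (ivl p q).prod (ivl r t) := by
    have h := Measure.map_prod_map ((ivl p q).prod (ivl r t)) (ivl p q)
      (measurable_snd (α := ℝ) (β := ℝ)) (measurable_id (α := ℝ))
    rw [Measure.map_snd_prod, Measure.map_id, Measure.prod_smul_left] at h
    have h' := congrArg (Measure.map Prod.swap) h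
    rw [Measure.map_smul, Measure.prod_swap,
      Measure.map_map measurable_swap (measurable_snd.prodMap measurable_id)] at h'
    exact h'.symm
  have hs : MeasurableSet {z : (ℝ × ℝ) × ℝ | z.2 ≤ z.1.1} :=
    measurableSet_le measurable_snd (measurable_fst.comp measurable_fst)
  have hi : Integrable ({z : (ℝ × ℝ) × ℝ | z.2 ≤ z.1.1}.indicator fun z => g (z.2, z.1.2))
      (((ivl p q).prod (ivl r t)).prod (ivl p q)) := by
    refine Integrable.indicator (Integrable.comp_measurable (g := g)
      (f := fun z : (ℝ × ℝ) × ℝ => (z.2, z.1.2)) ?_ (by fun_prop)) hs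
    rw [hmap]
    exact hg.smul_measure (measure_ne_top _ _)
  refine hi.integral_prod_left.congr ?_
  have hx : ∀ᵐ z ∂((ivl p q).prod (ivl r t)), z.1 ∈ Icc p q :=
    Measure.quasiMeasurePreserving_fst.ae (ae_mem_ivl p q)
  filter_upwards [hx] with z hz
  have : (fun σ => {z : (ℝ × ℝ) × ℝ | z.2 ≤ z.1.1}.indicator
      (fun z => g (z.2, z.1.2)) (z, σ)) = (Iic z.1).indicator fun σ => g (σ, z.2) := by
    funext σ
    by_cases h : σ ≤ z.1 <;> simp [h, indicator]
  rw [this, integral_indicator_Iic_ivl hz]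

variable [CompleteSpace E]

/-- An integrable function annihilated by all test functions vanishes. -/
theorem ae_eq_zero_of_test {f : ℝ → E} (hf : Integrable f (ivl p q))
    (h : ∀ η, IsTest p q η → ∫ s, η s • f s ∂(ivl p q) = 0) : f =ᵐ[ivl p q] 0 := by
  have h1 : ∀ᵐ x ∂(ivl p q), x ∈ Ioo p q → f x = 0 :=
    isOpen_Ioo.ae_eq_zero_of_integral_contDiff_smul_eq_zero
      (hf.locallyIntegrable.locallyIntegrableOn _) fun g h1 h2 h3 => h g ⟨h1, h2, h3⟩
  have h2 : ∀ᵐ x ∂(ivl p q), x ∈ Ioo p q := by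
    have : ivl p q = volume.restrict (Ioo p q) := Measure.restrict_congr_set Ioo_ae_eq_Icc.symm
    rw [this]
    exact ae_restrict_mem measurableSet_Ioo
  filter_upwards [h1, h2] with x h3 h4 using h3 h4

/-- An integrable function on a rectangle annihilated by all products of test functions
vanishes. -/
theorem ae_eq_zero_of_test_prod {f : ℝ × ℝ → E}
    (hf : Integrable f ((ivl p q).prod (ivl r t)))
    (h : ∀ η ζ, IsTest p q η → IsTest r t ζ →
      ∫ z, (η z.1 * ζ z.2) • f z ∂((ivl p q).prod (ivl r t)) = 0) :
    f =ᵐ[(ivl p q).prod (ivl r t)] 0 := by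
  have hrect : ∀ S T : Set ℝ, MeasurableSet S → MeasurableSet T →
      ∫ z in S ×ˢ T, f z ∂((ivl p q).prod (ivl r t)) = 0 := by
    intro S T hS hT
    -- The variables are treated one at a time: for fixed `ζ` the one-variable result in `s`
    -- replaces `η` by the indicator of `S`; then, with `S` fixed, the one in `x` removes `ζ`.
    have h1 : ∀ ζ, IsTest r t ζ →
        (fun s => ∫ x, ζ x • f (s, x) ∂(ivl r t)) =ᵐ[ivl p q] 0 := by
      intro ζ hζ
      obtain ⟨C, hC⟩ := hζ.exists_bound
      have hi : Integrable (fun z : ℝ × ℝ => ζ z.2 • f z) ((ivl p q).prod (ivl r t)) :=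
        hf.bdd_smul C (hζ.continuous.comp continuous_snd).aestronglyMeasurable
          (ae_of_all _ fun z => hC z.2)
      refine ae_eq_zero_of_test hi.integral_prod_left fun η hη => ?_
      have h2 := h η ζ hη hζ
      rw [integral_prod _ (hη.integrable_mul_smul hζ hf)] at h2
      rw [← h2]
      refine integral_congr_ae (ae_of_all _ fun s => ?_)
      simp only [mul_smul, integral_smul]
    have hfS : Integrable f (((ivl p q).restrict S).prod (ivl r t)) := by
      have : ((ivl p q).restrict S).prod (ivl r t) =
          ((ivl p q).prod (ivl r t)).restrict (S ×ˢ univ) := by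
        rw [← Measure.prod_restrict, Measure.restrict_univ]
      rw [this]
      exact hf.restrict
    have h3 : (fun x => ∫ s, f (s, x) ∂((ivl p q).restrict S)) =ᵐ[ivl r t] 0 := by
      refine ae_eq_zero_of_test hfS.integral_prod_right fun ζ hζ => ?_
      obtain ⟨C, hC⟩ := hζ.exists_bound
      have hi : Integrable (fun z : ℝ × ℝ => ζ z.2 • f z)
          (((ivl p q).restrict S).prod (ivl r t)) :=
        hfS.bdd_smul C (hζ.continuous.comp continuous_snd).aestronglyMeasurable
          (ae_of_all _ fun z => hC z.2)
      simp only [← integral_smul]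
      rw [← integral_prod_symm _ hi, integral_prod _ hi,
        integral_congr_ae (ae_restrict_of_ae (h1 ζ hζ))]
      simp
    rw [← Measure.prod_restrict, integral_prod_symm]
    · rw [integral_congr_ae (ae_restrict_of_ae h3)]
      simp
    · rw [Measure.prod_restrict]
      exact hf.restrict
  refine ae_eq_zero_of_forall_setIntegral_eq_of_sigmaFinite (fun s _ _ => hf.integrableOn)
    fun s hs _ => ?_
  -- Vanishing integrals pass from measurable rectangles, a π-system, to all measurable sets by
  -- Dynkin's argument.
  refine MeasurableSpace.induction_on_inter
    (C := fun s _ => ∫ z in s, f z ∂((ivl p q).prod (ivl r t)) = 0) generateFrom_prod.symm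
    isPiSystem_prod (by simp) ?_ ?_ ?_ s hs
  · rintro _ ⟨S, hS, T, hT, rfl⟩
    exact hrect S T hS hT
  · intro s hs h0
    have h1 := integral_add_compl hs hf
    have h2 := hrect univ univ MeasurableSet.univ MeasurableSet.univ
    rw [univ_prod_univ, Measure.restrict_univ] at h2
    rwa [h0, h2, zero_add] at h1
  · intro g hd hm h0
    rw [integral_iUnion hm hd hf.integrableOn]
    simp [h0]

/-- Integration by parts against a function vanishing at the right end point. -/
theorem integral_deriv_smul_primitive {g : ℝ → E} (hg : Integrable g (ivl p q))
    {η : ℝ → ℝ} (hη : ContDiff ℝ 1 η) (hηq : η q = 0) :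
    ∫ s, deriv η s • (∫ σ in p..s, g σ) ∂(ivl p q) = -∫ s, η s • g s ∂(ivl p q) := by
  have hs : MeasurableSet {z : ℝ × ℝ | z.2 ≤ z.1} := measurableSet_le measurable_snd measurable_fst
  have hc : Continuous (deriv η) := hη.continuous_deriv le_rfl
  -- Integration by parts is done as Fubini on the triangle `σ ≤ s`, so `g` need only be integrable.
  -- The primitive vanishes at `p`, so no condition on `η(p)` is required.
  have hi : Integrable ({z : ℝ × ℝ | z.2 ≤ z.1}.indicator fun z => deriv η z.1 • g z.2)
      ((ivl p q).prod (ivl p q)) := by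
    obtain ⟨C, hC⟩ := (isCompact_Icc (a := p) (b := q)).exists_bound_of_continuousOn
      hc.continuousOn
    exact ((hg.comp_snd (ivl p q)).bdd_smul C (hc.comp continuous_fst).aestronglyMeasurable
      (Measure.quasiMeasurePreserving_fst.ae ((ae_mem_ivl p q).mono hC))).indicator hs
  have h1 : ∫ s, deriv η s • (∫ σ in p..s, g σ) ∂(ivl p q) =
      ∫ s, ∫ σ, {z : ℝ × ℝ | z.2 ≤ z.1}.indicator (fun z => deriv η z.1 • g z.2) (s, σ)
        ∂(ivl p q) ∂(ivl p q) := by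
    refine integral_congr_ae ?_
    filter_upwards [ae_mem_ivl p q] with s hs'
    have : (fun σ => {z : ℝ × ℝ | z.2 ≤ z.1}.indicator (fun z => deriv η z.1 • g z.2) (s, σ)) =
        (Iic s).indicator fun σ => deriv η s • g σ := by
      funext σ
      by_cases h : σ ≤ s <;> simp [h, indicator]
    rw [this, integral_indicator_Iic_ivl hs', intervalIntegral.integral_smul]
  rw [h1, integral_integral_swap (f := fun s σ =>
    {z : ℝ × ℝ | z.2 ≤ z.1}.indicator (fun z => deriv η z.1 • g z.2) (s, σ)) hi, ← integral_neg]
  refine integral_congr_ae ?_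
  filter_upwards [ae_mem_ivl p q] with σ hσ
  have : (fun s => {z : ℝ × ℝ | z.2 ≤ z.1}.indicator (fun z => deriv η z.1 • g z.2) (s, σ)) =
      (Ici σ).indicator fun s => deriv η s • g σ := by
    funext s
    by_cases h : σ ≤ s <;> simp [h, indicator]
  have hint : ∫ s in σ..q, deriv η s = -η σ := by
    rw [intervalIntegral.integral_deriv_eq_sub, hηq, zero_sub]
    · exact fun x _ => (hη.differentiable (by simp)).differentiableAt
    · exact hc.intervalIntegrable _ _
  rw [this, integral_indicator measurableSet_Ici, Measure.restrict_restrict measurableSet_Ici,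
    integral_smul_const, ← neg_smul, ← hint,
    intervalIntegral.integral_of_le hσ.2, ← integral_Icc_eq_integral_Ioc]
  congr 3
  ext s
  simp only [mem_inter_iff, mem_Ici, mem_Icc]
  exact ⟨fun h => ⟨h.1, h.2.2⟩, fun h => ⟨h.1, hσ.1.trans h.1, h.2⟩⟩

/-- A double primitive as a single integral. -/
theorem integral_primitive {g : ℝ → E} (hg : Integrable g (ivl p q)) {x : ℝ}
    (hx : x ∈ Icc p q) :
    ∫ y in p..x, ∫ θ in p..y, g θ = ∫ θ in p..x, (x - θ) • g θ := by
  -- The weight `y ↦ x - y` has derivative `-1` and vanishes at the right end of `[p, x]`.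
  have h := integral_deriv_smul_primitive (p := p) (q := x) (g := g)
    (hg.mono_measure (Measure.restrict_mono (Icc_subset_Icc_right hx.2) le_rfl))
    (η := fun y => x - y) (by fun_prop) (sub_self x)
  rw [integral_ivl hx.1, integral_ivl hx.1] at h
  simpa [deriv_const_sub] using h

/-- The constant drops out because `η'` has mean zero, leaving the integration by parts for the
primitive. -/
theorem integral_deriv_smul_of_eq_primitive {f g : ℝ → E} (hg : Integrable g (ivl p q)) {c : E}
    (hf : ∀ᵐ s ∂(ivl p q), f s = c + ∫ σ in p..s, g σ) {η : ℝ → ℝ} (hη : IsTest p q η) :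
    ∫ s, deriv η s • f s ∂(ivl p q) = -∫ s, η s • g s ∂(ivl p q) := by
  rcases le_or_gt p q with hpq | hpq
  · have h1 : ∫ s, deriv η s • f s ∂(ivl p q) =
        ∫ s, (deriv η s • c + deriv η s • ∫ σ in p..s, g σ) ∂(ivl p q) := by
      refine integral_congr_ae ?_
      filter_upwards [hf] with s hs
      rw [hs, smul_add]
    rw [h1, integral_add (hη.deriv.integrable_smul (integrable_const c))
      (hη.deriv.integrable_smul (integrable_primitive hg)),
      integral_deriv_smul_primitive hg (hη.contDiff.of_le (by simp)) hη.right,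
      integral_smul_const, integral_ivl hpq, hη.intervalIntegral_deriv, hη.left]
    simp
  · simp [Icc_eq_empty_of_lt hpq]

/-- A function with vanishing weak derivative is constant, and more generally a function with weak
derivative `g` is a primitive of `g` up to a constant. -/
theorem exists_eq_add_primitive (hpq : p < q) {f g : ℝ → E} (hf : Integrable f (ivl p q))
    (hg : Integrable g (ivl p q))
    (h : ∀ η, IsTest p q η →
      ∫ s, deriv η s • f s ∂(ivl p q) = -∫ s, η s • g s ∂(ivl p q)) :
    ∃ c, ∀ᵐ s ∂(ivl p q), f s = c + ∫ σ in p..s, g σ := by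
  obtain ⟨ρ, hρ, hρ1⟩ := exists_test_integral_eq_one hpq
  have hG : Integrable (fun s => ∫ σ in p..s, g σ) (ivl p q) := integrable_primitive hg
  set F : ℝ → E := fun s => f s - ∫ σ in p..s, g σ with hF
  have hFi : Integrable F (ivl p q) := hf.sub hG
  have hF0 : ∀ η, IsTest p q η → ∫ s, deriv η s • F s ∂(ivl p q) = 0 := fun η hη => by
    simp only [hF, smul_sub]
    rw [integral_sub (hη.deriv.integrable_smul hf) (hη.deriv.integrable_smul hG), h η hη,
      integral_deriv_smul_primitive hg (hη.contDiff.of_le (by simp)) hη.right, sub_self]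
  -- This is the du Bois-Reymond argument. `F` is to be constant, so its value is its average
  -- against `ρ` of mass one.
  refine ⟨∫ s, ρ s • F s ∂(ivl p q), ?_⟩
  have hz : (fun s => F s - ∫ s, ρ s • F s ∂(ivl p q)) =ᵐ[ivl p q] 0 := by
    refine ae_eq_zero_of_test (hFi.sub (integrable_const _)) fun η hη => ?_
    -- Since `η - (∫ η) ρ` is the derivative of a test function, `F` annihilates it; hence `∫ η F =
    -- (∫ η) ∫ ρ F`.
    obtain ⟨e, he, hde⟩ := (hη.sub_smul hρ (∫ s in p..q, η s)).exists_primitive (by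
      rw [intervalIntegral.integral_sub (hη.continuous.intervalIntegrable _ _)
        ((hρ.continuous.intervalIntegrable _ _).const_mul _),
        intervalIntegral.integral_const_mul, hρ1, mul_one, sub_self])
    have h1 := hF0 e he
    simp only [hde, sub_smul, mul_smul] at h1
    rw [integral_sub (hη.integrable_smul hFi) ((hρ.integrable_smul hFi).fun_smul _), integral_smul,
      sub_eq_zero] at h1
    simp only [smul_sub]
    rw [integral_sub (hη.integrable_smul hFi) (hη.integrable_smul (integrable_const _)),
      integral_smul_const, h1, integral_ivl hpq.le η, sub_self]
  filter_upwards [hz] with s hs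
  rw [Pi.zero_apply, sub_eq_zero] at hs
  rw [← hs, hF]
  simp

theorem integral_prod_deriv_smul_primitive {g : ℝ × ℝ → E}
    (hg : Integrable g ((ivl p q).prod (ivl r t))) {η ζ : ℝ → ℝ} (hη : IsTest p q η)
    (hζ : IsTest r t ζ) :
    ∫ z, (deriv η z.1 * ζ z.2) • (∫ σ in p..z.1, g (σ, z.2)) ∂((ivl p q).prod (ivl r t)) =
      -∫ z, (η z.1 * ζ z.2) • g z ∂((ivl p q).prod (ivl r t)) := by
  rw [integral_prod_symm _ (hη.deriv.integrable_mul_smul hζ (integrable_primitive_prod hg)),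
    integral_prod_symm _ (hη.integrable_mul_smul hζ hg), ← integral_neg]
  refine integral_congr_ae ?_
  filter_upwards [hg.prod_left_ae] with x hx
  simp only [mul_comm _ (ζ x), mul_smul, integral_smul]
  rw [integral_deriv_smul_primitive hx (hη.contDiff.of_le (by simp)) hη.right, smul_neg]

/-- A function on a rectangle with weak derivative `g` in the first variable is a primitive of `g`
up to a function of the second variable. -/
theorem exists_eq_add_primitive_prod (hpq : p < q) {f g : ℝ × ℝ → E}
    (hf : Integrable f ((ivl p q).prod (ivl r t))) (hg : Integrable g ((ivl p q).prod (ivl r t)))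
    (h : ∀ η ζ, IsTest p q η → IsTest r t ζ →
      ∫ z, (deriv η z.1 * ζ z.2) • f z ∂((ivl p q).prod (ivl r t)) =
        -∫ z, (η z.1 * ζ z.2) • g z ∂((ivl p q).prod (ivl r t))) :
    ∃ c : ℝ → E, ∀ᵐ z ∂((ivl p q).prod (ivl r t)),
      f z = c z.2 + ∫ σ in p..z.1, g (σ, z.2) := by
  obtain ⟨ρ, hρ, hρ1⟩ := exists_test_integral_eq_one hpq
  have hG := integrable_primitive_prod hg
  set F : ℝ × ℝ → E := fun z => f z - ∫ σ in p..z.1, g (σ, z.2) with hF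
  have hFi : Integrable F ((ivl p q).prod (ivl r t)) := hf.sub hG
  have hF0 : ∀ η ζ, IsTest p q η → IsTest r t ζ →
      ∫ z, (deriv η z.1 * ζ z.2) • F z ∂((ivl p q).prod (ivl r t)) = 0 := fun η ζ hη hζ => by
    simp only [hF, smul_sub]
    rw [integral_sub (hη.deriv.integrable_mul_smul hζ hf) (hη.deriv.integrable_mul_smul hζ hG),
      h η ζ hη hζ, integral_prod_deriv_smul_primitive hg hη hζ, sub_self]
  -- The one-variable argument with a parameter: averaging against `ρ` in `s` yields a function of
  -- `x` in place of the constant.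
  set c : ℝ → E := fun x => ∫ s, ρ s • F (s, x) ∂(ivl p q) with hc
  have hρF : Integrable (fun z : ℝ × ℝ => ρ z.1 • F z) ((ivl p q).prod (ivl r t)) := by
    obtain ⟨C, hC⟩ := hρ.exists_bound
    exact hFi.bdd_smul C (hρ.continuous.comp continuous_fst).aestronglyMeasurable
      (ae_of_all _ fun z => hC z.1)
  have hci : Integrable c (ivl r t) := hρF.integral_prod_right
  refine ⟨c, ?_⟩
  have hz : (fun z : ℝ × ℝ => F z - c z.2) =ᵐ[(ivl p q).prod (ivl r t)] 0 := by
    refine ae_eq_zero_of_test_prod (hFi.sub (hci.comp_snd _)) fun η ζ hη hζ => ?_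
    obtain ⟨e, he, hde⟩ := (hη.sub_smul hρ (∫ s in p..q, η s)).exists_primitive (by
      rw [intervalIntegral.integral_sub (hη.continuous.intervalIntegrable _ _)
        ((hρ.continuous.intervalIntegrable _ _).const_mul _),
        intervalIntegral.integral_const_mul, hρ1, mul_one, sub_self])
    have h1 := hF0 e ζ he hζ
    simp only [hde, sub_mul, sub_smul, mul_assoc] at h1
    simp only [mul_smul (∫ s in p..q, η s)] at h1
    rw [integral_sub (hη.integrable_mul_smul hζ hFi) ((hρ.integrable_mul_smul hζ hFi).fun_smul _),
      integral_smul, sub_eq_zero] at h1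
    simp only [smul_sub]
    rw [integral_sub (hη.integrable_mul_smul hζ hFi)
      (hη.integrable_mul_smul hζ (hci.comp_snd _)), h1, sub_eq_zero,
      integral_prod_symm _ (hρ.integrable_mul_smul hζ hFi)]
    simp only [mul_smul]
    rw [integral_prod_smul (μ := ivl p q) (ν := ivl r t) η (fun x => ζ x • c x),
      integral_ivl hpq.le η]
    congr 1
    refine integral_congr_ae (ae_of_all _ fun x => ?_)
    simp only [hc, ← integral_smul]
    exact integral_congr_ae (ae_of_all _ fun s => smul_comm _ _ _)
  filter_upwards [hz] with z hz
  rw [Pi.zero_apply, sub_eq_zero] at hz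
  rw [← hz, hF]
  simp

end TestFunctions

/-! ### Commutation of 3-PI operators with integration along `s` -/

section Commutation

variable {n : ℕ} {a b : ℝ}

theorem integrable_L2 (v : L2 n a b) : Integrable v (ivl a b) :=
  (Lp.memLp v).integrable (by norm_num)

theorem integrable_L2R (v : L2R n a b) : Integrable v (rect a b) :=
  (Lp.memLp v).integrable (by norm_num)

theorem ae_ae_swap {p : ℝ × ℝ → Prop} (h : ∀ᵐ z ∂(rect a b), p z) :
    ∀ᵐ x ∂(ivl a b), ∀ᵐ s ∂(ivl 0 1), p (s, x) :=
  Measure.ae_ae_of_ae_prod (p := fun z : ℝ × ℝ => p z.swap)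
    (Measure.measurePreserving_swap.quasiMeasurePreserving.ae h)

theorem ext_slices {v w : L2R n a b}
    (h : ∀ᵐ s ∂(ivl 0 1), ∀ᵐ x ∂(ivl a b), v (s, x) = w (s, x)) : v = w := by
  refine Lp.ext ?_
  have hm : MeasurableSet {z | v z = w z} :=
    (Lp.stronglyMeasurable v).measurableSet_eq_fun (Lp.stronglyMeasurable w)
  exact (Measure.ae_prod_iff_ae_ae hm).2 h

theorem memLp_slice (v : L2R n a b) :
    ∀ᵐ s ∂(ivl 0 1), MemLp (fun x => v (s, x)) 2 (ivl a b) := by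
  have hv := Lp.memLp v
  have h2 : Integrable (fun z => ‖v z‖ ^ 2) (rect a b) :=
    (memLp_two_iff_integrable_sq_norm hv.1).1 hv
  filter_upwards [hv.1.prodMk_left, h2.prod_right_ae] with s h3 h4
  exact (memLp_two_iff_integrable_sq_norm h3).2 h4

theorem intervalIntegral_congr_ivl {E : Type*} [NormedAddCommGroup E] [NormedSpace ℝ E]
    {f g : ℝ → E} (h : f =ᵐ[ivl a b] g) {x y : ℝ} (hx : x ∈ Icc a b) (hy : y ∈ Icc a b) :
    ∫ θ in x..y, f θ = ∫ θ in x..y, g θ := by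
  refine intervalIntegral.integral_congr_ae ?_
  filter_upwards [(ae_restrict_iff' measurableSet_Icc).1 h] with θ hθ hm
  have := uIoc_subset_uIcc hm
  exact hθ (uIcc_subset_Icc hx hy this)

/-- `R.lift` acts on almost every slice as `R.op`. -/
theorem ThreePI.lift_slice (R : ThreePI n a b) (v : L2R n a b) :
    ∀ᵐ s ∂(ivl 0 1), ∀ w : L2 n a b, (∀ᵐ x ∂(ivl a b), v (s, x) = w x) →
      ∀ᵐ x ∂(ivl a b), R.lift v (s, x) = R.op w x := by
  -- The exceptional set of `s` is fixed before `w` is introduced, so `w` may later depend on `s`.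
  filter_upwards [Measure.ae_ae_of_ae_prod (R.lift_apply v)] with s hs w hw
  filter_upwards [hs, R.op_apply w, hw, ae_mem_ivl a b] with x h1 h2 h3 hx
  have hab : a ≤ b := hx.1.trans hx.2
  rw [h1, h2, h3]
  congr 2
  · refine intervalIntegral_congr_ivl ?_ ⟨le_rfl, hab⟩ hx
    filter_upwards [hw] with θ hθ
    rw [hθ]
  · refine intervalIntegral_congr_ivl ?_ hx ⟨hab, le_rfl⟩
    filter_upwards [hw] with θ hθ
    rw [hθ]

theorem ThreePI.lift_constS (R : ThreePI n a b) (w : L2 n a b) :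
    R.lift (constS n a b w) = constS n a b (R.op w) := by
  refine ext_slices ?_
  filter_upwards [R.lift_slice (constS n a b w), Measure.ae_ae_of_ae_prod (constS_apply w),
    Measure.ae_ae_of_ae_prod (constS_apply (R.op w))] with s h1 h2 h3
  filter_upwards [h1 w h2, h3] with x h4 h5
  rw [h4, h5]

theorem memLp_tensor {η : ℝ → ℝ} (hη : Continuous η) (w : L2 n a b) :
    MemLp (fun z : ℝ × ℝ => η z.1 • w z.2) 2 (rect a b) := by
  obtain ⟨C, hC⟩ := (isCompact_Icc (a := (0 : ℝ)) (b := 1)).exists_bound_of_continuousOn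
    hη.continuousOn
  have h1 : MemLp (fun z : ℝ × ℝ => η z.1) ⊤ (rect a b) := by
    refine memLp_top_of_bound (hη.comp continuous_fst).aestronglyMeasurable C ?_
    exact Measure.quasiMeasurePreserving_fst.ae ((ae_mem_ivl 0 1).mono hC)
  exact MemLp.smul (p := ⊤) (q := 2) (r := 2) ((Lp.memLp w).comp_snd (ivl 0 1)) h1

/-- The function `(s, x) ↦ η(s) w(x)`. -/
def tensor {η : ℝ → ℝ} (hη : Continuous η) (w : L2 n a b) : L2R n a b :=
  (memLp_tensor hη w).toLp _

theorem tensor_apply {η : ℝ → ℝ} (hη : Continuous η) (w : L2 n a b) :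
    ∀ᵐ z ∂(rect a b), tensor hη w z = η z.1 • w z.2 :=
  (memLp_tensor hη w).coeFn_toLp

theorem ThreePI.lift_tensor (R : ThreePI n a b) {η : ℝ → ℝ} (hη : Continuous η) (w : L2 n a b) :
    R.lift (tensor hη w) = tensor hη (R.op w) := by
  refine ext_slices ?_
  filter_upwards [R.lift_slice (tensor hη w), Measure.ae_ae_of_ae_prod (tensor_apply hη w),
    Measure.ae_ae_of_ae_prod (tensor_apply hη (R.op w))] with s h1 h2 h3
  have h4 := h1 (η s • w) (by
    filter_upwards [h2, Lp.coeFn_smul (η s) w] with x h5 h6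
    rw [h5, h6, Pi.smul_apply])
  rw [map_smul] at h4
  filter_upwards [h4, h3, Lp.coeFn_smul (η s) (R.op w)] with x h5 h6 h7
  rw [h5, h6, h7, Pi.smul_apply]

theorem volterra_tensor {η : ℝ → ℝ} (hη : Continuous η) (w : L2 n a b) :
    volterra n a b (tensor hη w) =
      tensor (η := fun s => ∫ ν in (0 : ℝ)..s, η ν)
        (intervalIntegral.continuous_primitive (fun _ _ => hη.intervalIntegrable _ _) 0) w := by
  refine Lp.ext ?_
  have hx : ∀ᵐ z ∂(rect a b), z.1 ∈ Icc (0 : ℝ) 1 :=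
    Measure.quasiMeasurePreserving_fst.ae (ae_mem_ivl 0 1)
  filter_upwards [volterra_apply (tensor hη w), tensor_apply (η := fun s => ∫ ν in (0 : ℝ)..s, η ν)
    (intervalIntegral.continuous_primitive (fun _ _ => hη.intervalIntegrable _ _) 0) w,
    Measure.quasiMeasurePreserving_snd.ae (ae_ae_swap (tensor_apply hη w)), hx] with z h1 h2 h3 hz
  rw [h1, h2, intervalIntegral_congr_ivl h3 (by simp) hz, intervalIntegral.integral_smul_const]

theorem integrateS_tensor {η : ℝ → ℝ} (hη : Continuous η) (w : L2 n a b) :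
    integrateS n a b (tensor hη w) = (∫ ν in (0 : ℝ)..1, η ν) • w := by
  refine Lp.ext ?_
  filter_upwards [integrateS_apply (tensor hη w), Lp.coeFn_smul (∫ ν in (0 : ℝ)..1, η ν) w,
    ae_ae_swap (tensor_apply hη w)] with x h1 h2 h3
  rw [h1, h2, intervalIntegral_congr_ivl h3 (by simp) (by simp),
    intervalIntegral.integral_smul_const, Pi.smul_apply]

/-- A function orthogonal to all `η(s) ζ(x) e` has vanishing integral against every product of test
functions, componentwise, and is therefore zero. -/
theorem dense_span_tensor :
    Dense (Submodule.span ℝ {v : L2R n a b | ∃ (η : ℝ → ℝ) (hη : Continuous η) (w : L2 n a b),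
      v = tensor hη w} : Set (L2R n a b)) := by
  rw [Submodule.dense_iff_topologicalClosure_eq_top, Submodule.topologicalClosure_eq_top_iff,
    Submodule.eq_bot_iff]
  intro F hF
  rw [Submodule.mem_orthogonal] at hF
  rw [Lp.eq_zero_iff_ae_eq_zero]
  refine ae_eq_zero_of_test_prod (integrable_L2R F) fun η ζ hη hζ => ?_
  refine ext_inner_left ℝ fun e => ?_
  obtain ⟨C, hC⟩ := hζ.exists_bound
  have hw : MemLp (fun x => ζ x • e) 2 (ivl a b) := by
    refine MemLp.of_bound (hζ.continuous.smul continuous_const).aestronglyMeasurable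
      (C * ‖e‖) (ae_of_all _ fun x => ?_)
    rw [norm_smul]
    exact mul_le_mul_of_nonneg_right (hC x) (norm_nonneg _)
  have h1 := hF _ (Submodule.subset_span ⟨η, hη.continuous, hw.toLp _, rfl⟩)
  rw [L2.inner_def] at h1
  rw [inner_zero_right, ← integral_inner (hη.integrable_mul_smul hζ (integrable_L2R F)), ← h1]
  refine integral_congr_ae ?_
  filter_upwards [tensor_apply hη.continuous (hw.toLp _),
    Measure.quasiMeasurePreserving_snd.ae hw.coeFn_toLp] with z h2 h3
  rw [h2, h3, smul_smul, inner_smul_left, inner_smul_right]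
  rfl

/-- Both compositions are bounded, so equality need only hold on the dense span of the tensors `η(s)
w(x)`. There integration acts on `η` alone and the 3-PI operator on `w` alone. -/
theorem ThreePI.volterra_lift (R : ThreePI n a b) (v : L2R n a b) :
    volterra n a b (R.lift v) = R.lift (volterra n a b v) := by
  have : volterra n a b ∘L R.lift = R.lift ∘L volterra n a b := by
    refine ContinuousLinearMap.ext_on dense_span_tensor ?_
    rintro _ ⟨η, hη, w, rfl⟩
    simp only [ContinuousLinearMap.comp_apply, R.lift_tensor, volterra_tensor]
  exact DFunLike.congr_fun this v

theorem ThreePI.integrateS_lift (R : ThreePI n a b) (v : L2R n a b) :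
    integrateS n a b (R.lift v) = R.op (integrateS n a b v) := by
  have : integrateS n a b ∘L R.lift = R.op ∘L integrateS n a b := by
    refine ContinuousLinearMap.ext_on dense_span_tensor ?_
    rintro _ ⟨η, hη, w, rfl⟩
    simp only [ContinuousLinearMap.comp_apply, R.lift_tensor, integrateS_tensor, map_smul]
  exact DFunLike.congr_fun this v

end Commutation

/-! ### Weak derivatives in one variable -/

section WeakDeriv

variable {n : ℕ} {a b : ℝ}

theorem HasWeakDeriv.unique {k : ℕ} {u g g' : L2 n a b} (h : HasWeakDeriv k u g)
    (h' : HasWeakDeriv k u g') : g = g' := by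
  have hz : (fun x => g x - g' x) =ᵐ[ivl a b] 0 := by
    refine ae_eq_zero_of_test ((integrable_L2 g).sub (integrable_L2 g')) fun η hη => ?_
    have h1 := (h η hη.1 hη.2 hη.3).symm.trans (h' η hη.1 hη.2 hη.3)
    simp only [smul_sub]
    rw [integral_sub (hη.integrable_smul (integrable_L2 g))
      (hη.integrable_smul (integrable_L2 g')), sub_eq_zero]
    exact smul_right_injective _ (pow_ne_zero k (by norm_num : (-1 : ℝ) ≠ 0)) h1
  refine Lp.ext ?_
  filter_upwards [hz] with x hx
  exact sub_eq_zero.1 hx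

theorem hasWeakDeriv_weakDeriv {k : ℕ} {u : L2 n a b} (h : ∃ g, HasWeakDeriv k u g) :
    HasWeakDeriv k u (weakDeriv k u) := Classical.epsilon_spec h

/-- Uniqueness turns the arbitrary choice behind `weakDeriv` into a computable value. -/
theorem HasWeakDeriv.weakDeriv_eq {k : ℕ} {u g : L2 n a b} (h : HasWeakDeriv k u g) :
    weakDeriv k u = g := (hasWeakDeriv_weakDeriv ⟨g, h⟩).unique h

theorem hasWeakDeriv_two_of_primitive {u v : L2 n a b} {g : ℝ → Vec n} {c d : Vec n}
    (hg : Integrable g (ivl a b)) (hu : ∀ᵐ x ∂(ivl a b), u x = c + ∫ y in a..x, g y)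
    (hgv : ∀ᵐ x ∂(ivl a b), g x = d + ∫ y in a..x, v y) : HasWeakDeriv 2 u v := by
  intro η h1 h2 h3
  have hη : IsTest a b η := ⟨h1, h2, h3⟩
  rw [iteratedDeriv_succ, iteratedDeriv_one, integral_deriv_smul_of_eq_primitive hg hu hη.deriv,
    integral_deriv_smul_of_eq_primitive (integrable_L2 v) hgv hη]
  simp

theorem pointValue_eq (hab : a < b) {u : L2 n a b} {f : ℝ → Vec n} (hf : ContinuousOn f (Icc a b))
    (hu : ∀ᵐ x ∂(ivl a b), u x = f x) {x : ℝ} (hx : x ∈ Icc a b) : pointValue u x = f x := by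
  have h := Classical.epsilon_spec (p := fun f : ℝ → Vec n =>
    ContinuousOn f (Icc a b) ∧ ∀ᵐ y ∂(ivl a b), u y = f y) ⟨f, hf, hu⟩
  refine Measure.eqOn_Icc_of_ae_eq volume hab.ne ?_ h.1 hf hx
  filter_upwards [h.2, hu] with y h1 h2
  exact h1.symm.trans h2

/-- Functions in `H₂` are double primitives of their second weak derivative. -/
theorem exists_eq_primitive_of_mem_SobolevH (hab : a < b) {u : L2 n a b}
    (hu : u ∈ SobolevH n a b 2) :
    ∃ c d : Vec n, (∀ᵐ x ∂(ivl a b), u x = c + ∫ y in a..x, weakDeriv 1 u y) ∧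
      ∀ᵐ x ∂(ivl a b), weakDeriv 1 u x = d + ∫ y in a..x, weakDeriv 2 u y := by
  have h1 := hasWeakDeriv_weakDeriv (hu 1 (by norm_num))
  have h2 := hasWeakDeriv_weakDeriv (hu 2 le_rfl)
  obtain ⟨c, hc⟩ := exists_eq_add_primitive hab (integrable_L2 u)
    (integrable_L2 (weakDeriv 1 u)) fun η hη => by
      have := h1 η hη.1 hη.2 hη.3
      rw [iteratedDeriv_one] at this
      rw [this]
      simp
  obtain ⟨d, hd⟩ := exists_eq_add_primitive hab (integrable_L2 (weakDeriv 1 u))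
    (integrable_L2 (weakDeriv 2 u)) fun η hη => by
      -- Testing `u_x` with `η'` and `u_xx` with `η` evaluates the same integral of `η'' u`. This
      -- makes `u_xx` the weak derivative of `u_x`.
      have e1 := h1 _ hη.deriv.1 hη.deriv.2 hη.deriv.3
      have e2 := h2 η hη.1 hη.2 hη.3
      rw [iteratedDeriv_one] at e1
      rw [iteratedDeriv_succ, iteratedDeriv_one, e1] at e2
      simp only [pow_one, neg_smul, one_smul] at e2
      rw [neg_eq_iff_eq_neg] at e2
      rw [e2]
      simp
  exact ⟨c, d, hc, hd⟩

theorem integrable_continuous_smul {k : ℝ → ℝ} (hk : Continuous k) {v : ℝ → Vec n}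
    (hv : Integrable v (ivl a b)) : Integrable (fun θ => k θ • v θ) (ivl a b) := by
  obtain ⟨C, hC⟩ := (isCompact_Icc (a := a) (b := b)).exists_bound_of_continuousOn hk.continuousOn
  exact hv.bdd_smul C hk.aestronglyMeasurable ((ae_mem_ivl a b).mono hC)

theorem _root_.MeasureTheory.Integrable.intervalIntegrable_ivl {E : Type*} [NormedAddCommGroup E]
    {f : ℝ → E} (hf : Integrable f (ivl a b)) {x y : ℝ} (hx : x ∈ Icc a b) (hy : y ∈ Icc a b) :
    IntervalIntegrable f volume x y :=
  (IntegrableOn.mono_set hf (uIcc_subset_Icc hx hy)).intervalIntegrable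

end WeakDeriv

/-! ### Inversion of the second derivative under the boundary conditions -/

namespace DPDE

variable {n : ℕ} (D : DPDE n)

/-- The traces `[u(a); u_x(a)] = -(BH)⁻¹ B [0; 0; ∫ (b - θ) v(θ) dθ; ∫ v(θ) dθ]` determined by
`u_xx = v`, as a function of the two moments of `v`. -/
def trace : Vec n × Vec n →ₗ[ℝ] (Fin 2 × Fin n → ℝ) where
  toFun m := -((D.B * D.H)⁻¹ *ᵥ (D.B *ᵥ stack ![0, 0, m.1, m.2]))
  map_add' m m' := by
    have : stack ![0, 0, (m + m').1, (m + m').2] =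
        stack ![0, 0, m.1, m.2] + stack ![0, 0, m'.1, m'.2] := by
      funext p
      obtain ⟨k, i⟩ := p
      match k with
      | 0 | 1 | 2 | 3 => simp [stack]
    rw [this, Matrix.mulVec_add, Matrix.mulVec_add, neg_add]
  map_smul' r m := by
    have : stack ![0, 0, (r • m).1, (r • m).2] = r • stack ![0, 0, m.1, m.2] := by
      funext p
      obtain ⟨k, i⟩ := p
      match k with
      | 0 | 1 | 2 | 3 => simp [stack]
    rw [this, Matrix.mulVec_smul, Matrix.mulVec_smul, RingHom.id_apply, smul_neg]

/-- The `k`-th block of the traces determined by the moments of `u_xx`. -/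
def traceBlock (k : Fin 2) : Vec n × Vec n →L[ℝ] Vec n :=
  LinearMap.toContinuousLinearMap
    { toFun := fun m => WithLp.toLp 2 fun i => D.trace m (k, i)
      map_add' := fun m m' => by
        rw [map_add]
        rfl
      map_smul' := fun r m => by
        rw [map_smul]
        rfl }

theorem stackMat_mulVec {k m : ℕ} (M : Fin k → Matrix (Fin n) (Fin m) ℝ) (w : Fin m → ℝ) :
    stackMat M *ᵥ w = stack fun l => WithLp.toLp 2 (M l *ᵥ w) := rfl

theorem Q_mulVec (θ : ℝ) (w : Vec n) : D.Q θ *ᵥ w.ofLp = stack ![0, 0, (D.b - θ) • w, w] := by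
  rw [Q, stackMat_mulVec]
  funext p
  obtain ⟨k, i⟩ := p
  match k with
  | 0 | 1 | 2 | 3 => simp [stack, Matrix.smul_mulVec]

theorem K_mulVec (x : ℝ) (y : Fin 2 × Fin n → ℝ) (i : Fin n) :
    (D.K x *ᵥ y) i = y (0, i) + (x - D.a) * y (1, i) := by
  simp [K, Matrix.mulVec, dotProduct, Fintype.sum_prod_type, Matrix.one_apply]

theorem H_mulVec (c d : Vec n) :
    D.H *ᵥ stack ![c, d] = stack ![c, d, c + (D.b - D.a) • d, d] := by
  funext p
  obtain ⟨k, i⟩ := p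
  match k with
  | 0 | 1 | 2 | 3 =>
    simp [H, stack, Matrix.mulVec, dotProduct, Fintype.sum_prod_type, Matrix.one_apply]

/-- `T₂(x, θ)` sees `w` only through the pair `((b - θ) w, w)`, linearly and affinely in `x`.
Integrating this pair over `θ` produces the moments, so `T₂` contributes the affine function
carrying the traces at `a`. -/
theorem T2_mulVec (x θ : ℝ) (w : Vec n) :
    WithLp.toLp 2 (D.T2 x θ *ᵥ w.ofLp) = D.traceBlock 0 ((D.b - θ) • w, w) +
      (x - D.a) • D.traceBlock 1 ((D.b - θ) • w, w) := by
  ext i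
  change (D.T2 x θ *ᵥ w.ofLp) i = D.trace ((D.b - θ) • w, w) (0, i) +
    (x - D.a) * D.trace ((D.b - θ) • w, w) (1, i)
  rw [← D.K_mulVec x, T2, Matrix.neg_mulVec, ← Matrix.mulVec_mulVec, ← Matrix.mulVec_mulVec,
    ← Matrix.mulVec_mulVec, Q_mulVec, ← Matrix.mulVec_neg]
  rfl

theorem T1_mulVec (x θ : ℝ) (w : Vec n) :
    WithLp.toLp 2 (D.T1 x θ *ᵥ w.ofLp) =
      (x - θ) • w + WithLp.toLp 2 (D.T2 x θ *ᵥ w.ofLp) := by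
  rw [T1, Matrix.add_mulVec, Matrix.smul_mulVec, Matrix.one_mulVec]
  rfl

theorem IsAffine.hasDerivAt {D : DPDE n} {T : ℝ → ℝ → Matrix (Fin n) (Fin n) ℝ}
    (hT : D.IsAffine T) (i j : Fin n) (x θ : ℝ) :
    HasDerivAt (fun y => T y θ i j) (partialX T x θ i j) x := by
  obtain ⟨c, d, -, -, h⟩ := hT i j
  have hd : DifferentiableAt ℝ (fun y => T y θ i j) x := by
    simp only [h]
    fun_prop
  exact hd.hasDerivAt

theorem partialX_T1 (x θ : ℝ) : partialX D.T1 x θ = 1 + partialX D.T2 x θ := by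
  ext i j
  have h1 : HasDerivAt (fun y => D.T1 y θ i j)
      ((1 : Matrix (Fin n) (Fin n) ℝ) i j + partialX D.T2 x θ i j) x := by
    have h2 := ((((hasDerivAt_id x).sub_const θ).mul_const
      ((1 : Matrix (Fin n) (Fin n) ℝ) i j)).add (IsAffine.hasDerivAt D.exists_T2 i j x θ))
    rw [one_mul] at h2
    exact h2
  exact h1.deriv

/-- The slope of the affine function of `x` in `T2_mulVec`. -/
theorem partialX_T2_mulVec (x θ : ℝ) (w : Vec n) :
    WithLp.toLp 2 (partialX D.T2 x θ *ᵥ w.ofLp) = D.traceBlock 1 ((D.b - θ) • w, w) := by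
  ext i
  have h1 : HasDerivAt (fun y => (D.T2 y θ *ᵥ w.ofLp) i) ((partialX D.T2 x θ *ᵥ w.ofLp) i) x := by
    simp only [Matrix.mulVec, dotProduct]
    exact HasDerivAt.fun_sum fun j _ => (IsAffine.hasDerivAt D.exists_T2 i j x θ).mul_const _
  have h2 : (fun y => (D.T2 y θ *ᵥ w.ofLp) i) = fun y =>
      D.traceBlock 0 ((D.b - θ) • w, w) i + (y - D.a) * D.traceBlock 1 ((D.b - θ) • w, w) i := by
    funext y
    exact congrFun (congrArg WithLp.ofLp (D.T2_mulVec y θ w)) i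
  rw [h2] at h1
  refine h1.unique ?_
  simpa using (((hasDerivAt_id x).sub_const D.a).mul_const
    (D.traceBlock 1 ((D.b - θ) • w, w) i)).const_add (D.traceBlock 0 ((D.b - θ) • w, w) i)

theorem partialX_T1_mulVec (x θ : ℝ) (w : Vec n) :
    WithLp.toLp 2 (partialX D.T1 x θ *ᵥ w.ofLp) =
      w + WithLp.toLp 2 (partialX D.T2 x θ *ᵥ w.ofLp) := by
  rw [partialX_T1, Matrix.add_mulVec, Matrix.one_mulVec]
  rfl

/-- The two moments of `v`. -/
def moments (v : ℝ → Vec n) : Vec n × Vec n :=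
  (∫ θ in D.a..D.b, (D.b - θ) • v θ, ∫ θ in D.a..D.b, v θ)

theorem integrable_moments {v : ℝ → Vec n} (hv : Integrable v (ivl D.a D.b)) :
    Integrable (fun θ => ((D.b - θ) • v θ, v θ)) (ivl D.a D.b) :=
  (integrable_continuous_smul (by fun_prop) hv).prodMk hv

theorem integral_traceBlock (k : Fin 2) {v : ℝ → Vec n} (hv : Integrable v (ivl D.a D.b)) :
    ∫ θ in D.a..D.b, D.traceBlock k ((D.b - θ) • v θ, v θ) = D.traceBlock k (D.moments v) := by
  rw [← integral_ivl D.hab.le, ContinuousLinearMap.integral_comp_comm _ (D.integrable_moments hv),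
    integral_pair (integrable_continuous_smul (by fun_prop) hv) hv, integral_ivl D.hab.le,
    integral_ivl D.hab.le]
  rfl

theorem integrable_T2 (x : ℝ) {v : ℝ → Vec n} (hv : Integrable v (ivl D.a D.b)) :
    Integrable (fun θ => WithLp.toLp 2 (D.T2 x θ *ᵥ (v θ).ofLp)) (ivl D.a D.b) := by
  simp only [T2_mulVec]
  exact ((D.traceBlock 0).integrable_comp (D.integrable_moments hv)).add
    (((D.traceBlock 1).integrable_comp (D.integrable_moments hv)).smul (x - D.a))

theorem integrable_T1 (x : ℝ) {v : ℝ → Vec n} (hv : Integrable v (ivl D.a D.b)) :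
    Integrable (fun θ => WithLp.toLp 2 (D.T1 x θ *ᵥ (v θ).ofLp)) (ivl D.a D.b) := by
  simp only [T1_mulVec]
  exact (integrable_continuous_smul (by fun_prop) hv).add (D.integrable_T2 x hv)

theorem integrable_partialX_T2 (x : ℝ) {v : ℝ → Vec n} (hv : Integrable v (ivl D.a D.b)) :
    Integrable (fun θ => WithLp.toLp 2 (partialX D.T2 x θ *ᵥ (v θ).ofLp)) (ivl D.a D.b) := by
  simp only [partialX_T2_mulVec]
  exact (D.traceBlock 1).integrable_comp (D.integrable_moments hv)

theorem integrable_partialX_T1 (x : ℝ) {v : ℝ → Vec n} (hv : Integrable v (ivl D.a D.b)) :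
    Integrable (fun θ => WithLp.toLp 2 (partialX D.T1 x θ *ᵥ (v θ).ofLp)) (ivl D.a D.b) := by
  simp only [partialX_T1_mulVec]
  exact hv.add (D.integrable_partialX_T2 x hv)

/-- The kernels `T₁`, `T₂` produce the function with second derivative `v` and traces determined
by the moments of `v`. -/
theorem integral_T {v : ℝ → Vec n} (hv : Integrable v (ivl D.a D.b)) {x : ℝ}
    (hx : x ∈ Icc D.a D.b) :
    (∫ θ in D.a..x, WithLp.toLp 2 (D.T1 x θ *ᵥ (v θ).ofLp)) +
      ∫ θ in x..D.b, WithLp.toLp 2 (D.T2 x θ *ᵥ (v θ).ofLp) =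
    D.traceBlock 0 (D.moments v) + (x - D.a) • D.traceBlock 1 (D.moments v) +
      ∫ θ in D.a..x, (x - θ) • v θ := by
  have ha : D.a ∈ Icc D.a D.b := left_mem_Icc.2 D.hab.le
  have hb : D.b ∈ Icc D.a D.b := right_mem_Icc.2 D.hab.le
  have h2 := D.integrable_T2 x hv
  simp only [T1_mulVec]
  -- With `T₁ = (x - θ) I + T₂`, the two `T₂` integrals merge into one over `[a, b]`, and `(x - θ)`
  -- remains as the Taylor remainder.
  rw [intervalIntegral.integral_add
    ((integrable_continuous_smul (by fun_prop) hv).intervalIntegrable_ivl ha hx)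
    (h2.intervalIntegrable_ivl ha hx), add_assoc,
    intervalIntegral.integral_add_adjacent_intervals (h2.intervalIntegrable_ivl ha hx)
      (h2.intervalIntegrable_ivl hx hb), add_comm]
  congr 1
  simp only [T2_mulVec]
  have hi := fun k => (D.traceBlock k).integrable_comp (D.integrable_moments hv)
  rw [intervalIntegral.integral_add ((hi 0).intervalIntegrable_ivl ha hb)
    (((hi 1).fun_smul (x - D.a)).intervalIntegrable_ivl ha hb), intervalIntegral.integral_smul,
    D.integral_traceBlock 0 hv, D.integral_traceBlock 1 hv]

theorem integral_partialX_T {v : ℝ → Vec n} (hv : Integrable v (ivl D.a D.b)) {x : ℝ}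
    (hx : x ∈ Icc D.a D.b) :
    (∫ θ in D.a..x, WithLp.toLp 2 (partialX D.T1 x θ *ᵥ (v θ).ofLp)) +
      ∫ θ in x..D.b, WithLp.toLp 2 (partialX D.T2 x θ *ᵥ (v θ).ofLp) =
    D.traceBlock 1 (D.moments v) + ∫ θ in D.a..x, v θ := by
  have ha : D.a ∈ Icc D.a D.b := left_mem_Icc.2 D.hab.le
  have hb : D.b ∈ Icc D.a D.b := right_mem_Icc.2 D.hab.le
  have h2 := D.integrable_partialX_T2 x hv
  simp only [partialX_T1_mulVec]
  rw [intervalIntegral.integral_add (hv.intervalIntegrable_ivl ha hx)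
    (h2.intervalIntegrable_ivl ha hx), add_assoc,
    intervalIntegral.integral_add_adjacent_intervals (h2.intervalIntegrable_ivl ha hx)
      (h2.intervalIntegrable_ivl hx hb), add_comm]
  congr 1
  simp only [partialX_T2_mulVec]
  exact D.integral_traceBlock 1 hv

theorem opT1_apply (v : L2 n D.a D.b) : ∀ᵐ x ∂(ivl D.a D.b), D.paramsT.op v x =
    D.traceBlock 0 (D.moments v) + (x - D.a) • D.traceBlock 1 (D.moments v) +
      ∫ θ in D.a..x, (x - θ) • v θ := by
  filter_upwards [D.paramsT.op_apply v, ae_mem_ivl D.a D.b] with x h1 hx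
  rw [h1, ← D.integral_T (integrable_L2 v) hx]
  simp [paramsT]

theorem primitive_const_add {v : ℝ → Vec n} (hv : Integrable v (ivl D.a D.b)) (d : Vec n) {x : ℝ}
    (hx : x ∈ Icc D.a D.b) :
    ∫ y in D.a..x, (d + ∫ θ in D.a..y, v θ) =
      (x - D.a) • d + ∫ θ in D.a..x, (x - θ) • v θ := by
  rw [intervalIntegral.integral_add intervalIntegrable_const
    ((integrable_primitive hv).intervalIntegrable_ivl (left_mem_Icc.2 D.hab.le) hx),
    integral_primitive hv hx, intervalIntegral.integral_const]

/-- `𝒯₁ v` has second derivative `v`. -/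
theorem hasWeakDeriv_opT1 (v : L2 n D.a D.b) : HasWeakDeriv 2 (D.paramsT.op v) v := by
  refine hasWeakDeriv_two_of_primitive (c := D.traceBlock 0 (D.moments v))
    (d := D.traceBlock 1 (D.moments v))
    (g := fun y => D.traceBlock 1 (D.moments v) + ∫ θ in D.a..y, v θ)
    ((integrable_const _).add (integrable_primitive (integrable_L2 v))) ?_ (ae_of_all _ fun _ => rfl)
  filter_upwards [D.opT1_apply v, ae_mem_ivl D.a D.b] with x h1 hx
  rw [h1, D.primitive_const_add (integrable_L2 v) _ hx, add_assoc]

/-- Elements of `X_B` and their first derivatives, in terms of the second derivative. -/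
theorem eq_of_mem_XB (hBH : IsUnit (D.B * D.H)) {u : L2 n D.a D.b} (hu : u ∈ D.XB) :
    (∀ᵐ x ∂(ivl D.a D.b), u x = D.traceBlock 0 (D.moments (weakDeriv 2 u)) +
      (x - D.a) • D.traceBlock 1 (D.moments (weakDeriv 2 u)) +
        ∫ θ in D.a..x, (x - θ) • weakDeriv 2 u θ) ∧
    ∀ᵐ x ∂(ivl D.a D.b), weakDeriv 1 u x = D.traceBlock 1 (D.moments (weakDeriv 2 u)) +
      ∫ θ in D.a..x, weakDeriv 2 u θ := by
  have ha : D.a ∈ Icc D.a D.b := left_mem_Icc.2 D.hab.le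
  have hb : D.b ∈ Icc D.a D.b := right_mem_Icc.2 D.hab.le
  obtain ⟨c, d, hc, hd⟩ := exists_eq_primitive_of_mem_SobolevH D.hab hu.1
  set v := weakDeriv 2 u
  set u1 := weakDeriv 1 u
  have hv := integrable_L2 v
  have hc' : ∀ᵐ x ∂(ivl D.a D.b), u x =
      c + ((x - D.a) • d + ∫ θ in D.a..x, (x - θ) • v θ) := by
    filter_upwards [hc, ae_mem_ivl D.a D.b] with x h1 hx
    rw [h1, ← D.primitive_const_add hv _ hx, intervalIntegral_congr_ivl hd ha hx]
  have hcont : ContinuousOn (fun x => c + ∫ y in D.a..x, u1 y) (Icc D.a D.b) :=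
    continuousOn_const.add (continuousOn_primitive_ivl (integrable_L2 u1))
  have hcont1 : ContinuousOn (fun x => d + ∫ y in D.a..x, v y) (Icc D.a D.b) :=
    continuousOn_const.add (continuousOn_primitive_ivl hv)
  have e1 : pointValue u D.a = c := by simpa using pointValue_eq D.hab hcont hc ha
  have e2 : pointValue u1 D.a = d := by simpa using pointValue_eq D.hab hcont1 hd ha
  -- At `x = b` the Taylor remainder `∫ (b - θ) v(θ) dθ` is the first moment; the second moment
  -- appears in the same way in `u_x(b)`.
  have e3 : pointValue u D.b = c + (D.b - D.a) • d + (D.moments v).1 := by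
    rw [pointValue_eq D.hab hcont hc hb, intervalIntegral_congr_ivl hd ha hb,
      D.primitive_const_add hv _ hb, add_assoc]
    rfl
  have e4 : pointValue u1 D.b = d + (D.moments v).2 := pointValue_eq D.hab hcont1 hd hb
  have hB := hu.2
  change D.B *ᵥ stack ![pointValue u D.a, pointValue u1 D.a, pointValue u D.b,
    pointValue u1 D.b] = 0 at hB
  have hst : stack ![pointValue u D.a, pointValue u1 D.a, pointValue u D.b, pointValue u1 D.b] =
      D.H *ᵥ stack ![c, d] + stack ![0, 0, (D.moments v).1, (D.moments v).2] := by
    rw [H_mulVec, e1, e2, e3, e4]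
    funext p
    obtain ⟨k, i⟩ := p
    match k with
    | 0 | 1 | 2 | 3 => simp [stack]
  rw [hst, Matrix.mulVec_add, Matrix.mulVec_mulVec, add_eq_zero_iff_eq_neg] at hB
  -- The boundary conditions now read `BH [c; d] = -B [0; 0; m₁; m₂]`, with `m₁`, `m₂` the moments
  -- of `v`. Invertibility of `BH` determines the traces.
  have htr : stack ![c, d] = D.trace (D.moments v) := by
    have h1 := congrArg (fun y => (D.B * D.H)⁻¹ *ᵥ y) hB
    simp only [Matrix.mulVec_mulVec] at h1
    rw [Matrix.nonsing_inv_mul _ ((Matrix.isUnit_iff_isUnit_det _).1 hBH), Matrix.one_mulVec,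
      Matrix.mulVec_neg] at h1
    exact h1
  have hc0 : c = D.traceBlock 0 (D.moments v) := by
    ext i
    exact congrFun htr (0, i)
  have hd0 : d = D.traceBlock 1 (D.moments v) := by
    ext i
    exact congrFun htr (1, i)
  rw [← hc0, ← hd0]
  refine ⟨?_, hd⟩
  filter_upwards [hc'] with x h1
  rw [h1, add_assoc]

/-- Together with `hasWeakDeriv_opT1`, this makes `𝒯₁` a left inverse of `∂ₓ²` on `X_B` and `∂ₓ²` a
left inverse of `𝒯₁` on `L₂`. -/
theorem opT1_weakDeriv (hBH : IsUnit (D.B * D.H)) {u : L2 n D.a D.b} (hu : u ∈ D.XB) :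
    D.paramsT.op (weakDeriv 2 u) = u := by
  refine Lp.ext ?_
  filter_upwards [D.opT1_apply (weakDeriv 2 u), (D.eq_of_mem_XB hBH hu).1] with x h1 h2
  rw [h1, h2]

/-- `(p, q) ↦ C [p; q; 0]`. -/
def jetMul (C : Matrix (Fin n) (Fin 3 × Fin n) ℝ) : Vec n × Vec n →L[ℝ] Vec n :=
  LinearMap.toContinuousLinearMap
    { toFun := fun m => WithLp.toLp 2 (C *ᵥ stack ![m.1, m.2, 0])
      map_add' := fun m m' => by
        have : stack ![(m + m').1, (m + m').2, 0] =
            stack ![m.1, m.2, 0] + stack ![m'.1, m'.2, 0] := by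
          funext p
          obtain ⟨k, i⟩ := p
          match k with
          | 0 | 1 | 2 => simp [stack]
        rw [this, Matrix.mulVec_add]
        rfl
      map_smul' := fun r m => by
        have : stack ![(r • m).1, (r • m).2, 0] = r • stack ![m.1, m.2, 0] := by
          funext p
          obtain ⟨k, i⟩ := p
          match k with
          | 0 | 1 | 2 => simp [stack]
        rw [this, Matrix.mulVec_smul]
        rfl }

theorem dynKer_mulVec (C : ℝ → Matrix (Fin n) (Fin 3 × Fin n) ℝ)
    (T : ℝ → ℝ → Matrix (Fin n) (Fin n) ℝ) (x θ : ℝ) (w : Vec n) :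
    WithLp.toLp 2 (dynKer C T x θ *ᵥ w.ofLp) = jetMul (C x)
      (WithLp.toLp 2 (T x θ *ᵥ w.ofLp), WithLp.toLp 2 (partialX T x θ *ᵥ w.ofLp)) := by
  rw [dynKer, ← Matrix.mulVec_mulVec]
  have : stackMat ![T x θ, partialX T x θ, 0] *ᵥ w.ofLp =
      stack ![WithLp.toLp 2 (T x θ *ᵥ w.ofLp), WithLp.toLp 2 (partialX T x θ *ᵥ w.ofLp), 0] := by
    rw [stackMat_mulVec]
    funext p
    obtain ⟨k, i⟩ := p
    match k with
    | 0 | 1 | 2 => simp [stack]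
  rw [this]
  rfl

/-- `𝒫_C u_xx = C [u; u_x; u_xx]` for `u ∈ X_B`. -/
theorem dynParams_op_weakDeriv (hBH : IsUnit (D.B * D.H))
    {C : ℝ → Matrix (Fin n) (Fin 3 × Fin n) ℝ}
    (hC : ∀ i j, MemLp (fun x => C x i j) ⊤ (ivl D.a D.b)) {u : L2 n D.a D.b} (hu : u ∈ D.XB) :
    ∀ᵐ x ∂(ivl D.a D.b), (D.dynParams C hC).op (weakDeriv 2 u) x =
      WithLp.toLp 2 (C x *ᵥ D.jet u x) := by
  obtain ⟨h0, h1⟩ := D.eq_of_mem_XB hBH hu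
  filter_upwards [(D.dynParams C hC).op_apply (weakDeriv 2 u), h0, h1, ae_mem_ivl D.a D.b]
    with x hop hx0 hx1 hx
  have ha : D.a ∈ Icc D.a D.b := left_mem_Icc.2 D.hab.le
  have hb : D.b ∈ Icc D.a D.b := right_mem_Icc.2 D.hab.le
  have hv := integrable_L2 (weakDeriv 2 u)
  rw [← D.integral_T hv hx] at hx0
  rw [← D.integral_partialX_T hv hx] at hx1
  -- At fixed `x` the coefficient `C(x)` is a constant linear map, so it comes out of the
  -- `θ`-integral. What is left are the integrals giving `u` and `u_x`.
  have key : ∀ {T : ℝ → ℝ → Matrix (Fin n) (Fin n) ℝ},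
      Integrable (fun θ => WithLp.toLp 2 (T x θ *ᵥ (weakDeriv 2 u θ).ofLp)) (ivl D.a D.b) →
      Integrable (fun θ => WithLp.toLp 2 (partialX T x θ *ᵥ (weakDeriv 2 u θ).ofLp))
        (ivl D.a D.b) → ∀ {y z : ℝ}, y ∈ Icc D.a D.b → z ∈ Icc D.a D.b →
      ∫ θ in y..z, WithLp.toLp 2 (dynKer C T x θ *ᵥ (weakDeriv 2 u θ).ofLp) = jetMul (C x)
        (∫ θ in y..z, WithLp.toLp 2 (T x θ *ᵥ (weakDeriv 2 u θ).ofLp),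
          ∫ θ in y..z, WithLp.toLp 2 (partialX T x θ *ᵥ (weakDeriv 2 u θ).ofLp)) := by
    intro T hT hT' y z hy hz
    simp only [dynKer_mulVec]
    rw [ContinuousLinearMap.intervalIntegral_comp_comm _
      ((hT.prodMk hT').intervalIntegrable_ivl hy hz)]
    congr 1
    refine Prod.ext ?_ ?_
    · exact ((ContinuousLinearMap.fst ℝ (Vec n) (Vec n)).intervalIntegral_comp_comm
        ((hT.prodMk hT').intervalIntegrable_ivl hy hz)).symm
    · exact ((ContinuousLinearMap.snd ℝ (Vec n) (Vec n)).intervalIntegral_comp_comm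
        ((hT.prodMk hT').intervalIntegrable_ivl hy hz)).symm
  rw [hop]
  change WithLp.toLp 2 ((C x * stackMat ![0, 0, 1]) *ᵥ (weakDeriv 2 u x).ofLp) +
    ((∫ θ in D.a..x, WithLp.toLp 2 (dynKer C D.T1 x θ *ᵥ (weakDeriv 2 u θ).ofLp)) +
      ∫ θ in x..D.b, WithLp.toLp 2 (dynKer C D.T2 x θ *ᵥ (weakDeriv 2 u θ).ofLp)) = _
  rw [key (D.integrable_T1 x hv) (D.integrable_partialX_T1 x hv) ha hx,
    key (D.integrable_T2 x hv) (D.integrable_partialX_T2 x hv) hx hb, ← map_add, Prod.mk_add_mk,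
    ← hx0, ← hx1, ← Matrix.mulVec_mulVec]
  change WithLp.toLp 2 (C x *ᵥ stackMat ![0, 0, 1] *ᵥ (weakDeriv 2 u x).ofLp +
    C x *ᵥ stack ![u x, weakDeriv 1 u x, 0]) = _
  rw [← Matrix.mulVec_add]
  congr 2
  rw [stackMat_mulVec]
  funext p
  obtain ⟨k, i⟩ := p
  match k with
  | 0 | 1 | 2 => simp [jet, stack]

end DPDE

/-! ### Weak derivatives and slices on the rectangle -/

section WeakDerivR

variable {n : ℕ} {a b : ℝ}

theorem mixedDeriv_mul {η ζ : ℝ → ℝ} (hη : ContDiff ℝ ∞ η) (hζ : ContDiff ℝ ∞ ζ) (i j : ℕ)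
    (z : ℝ × ℝ) : mixedDeriv i j (fun z => η z.1 * ζ z.2) z =
      iteratedDeriv i η z.1 * iteratedDeriv j ζ z.2 := by
  have h1 : (fun s => iteratedDeriv j (fun x => η s * ζ x) z.2) =
      fun s => iteratedDeriv j ζ z.2 * η s := by
    funext s
    rw [iteratedDeriv_const_mul (η s) (hζ.contDiffAt.of_le (by exact_mod_cast le_top)), mul_comm]
  change iteratedDeriv i (fun s => iteratedDeriv j (fun x => η s * ζ x) z.2) z.1 = _
  rw [h1, iteratedDeriv_const_mul _ (hη.contDiffAt.of_le (by exact_mod_cast le_top)), mul_comm]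

/-- For product test functions the mixed derivative factors. This is the only form in which the
planar weak derivatives are used below. -/
theorem HasWeakDerivR.integral_prod {i j : ℕ} {φ g : L2R n a b} (h : HasWeakDerivR i j φ g)
    {η ζ : ℝ → ℝ} (hη : IsTest 0 1 η) (hζ : IsTest a b ζ) :
    ∫ z, (iteratedDeriv i η z.1 * iteratedDeriv j ζ z.2) • φ z ∂(rect a b) =
      (-1 : ℝ) ^ (i + j) • ∫ z, (η z.1 * ζ z.2) • g z ∂(rect a b) := by
  have hsub : tsupport (fun z : ℝ × ℝ => η z.1 * ζ z.2) ⊆ tsupport η ×ˢ tsupport ζ := by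
    refine closure_minimal (fun z hz => ?_) ((isClosed_tsupport _).prod (isClosed_tsupport _))
    exact ⟨subset_tsupport _ (left_ne_zero_of_mul hz), subset_tsupport _ (right_ne_zero_of_mul hz)⟩
  have h1 := h (fun z => η z.1 * ζ z.2)
    ((hη.contDiff.comp contDiff_fst).mul (hζ.contDiff.comp contDiff_snd))
    ((hη.hasCompactSupport.isCompact.prod hζ.hasCompactSupport.isCompact).of_isClosed_subset
      (isClosed_tsupport _) hsub)
    (hsub.trans (prod_mono hη.tsupport_subset hζ.tsupport_subset))
  simpa only [mixedDeriv_mul hη.contDiff hζ.contDiff] using h1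

theorem hasWeakDerivR_weakDerivR {i j : ℕ} {φ : L2R n a b} (h : ∃ g, HasWeakDerivR i j φ g) :
    HasWeakDerivR i j φ (weakDerivR i j φ) := Classical.epsilon_spec h

/-- If `g = ∂ₛ φ` weakly, tested against products, then `φ` is a primitive of `g` along `s`. -/
theorem exists_eq_constS_add_volterra {φ g : L2R n a b}
    (h : ∀ η ζ, IsTest 0 1 η → IsTest a b ζ →
      ∫ z, (deriv η z.1 * ζ z.2) • φ z ∂(rect a b) = -∫ z, (η z.1 * ζ z.2) • g z ∂(rect a b)) :
    ∃ d, φ = constS n a b d + volterra n a b g := by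
  obtain ⟨c, hc⟩ := exists_eq_add_primitive_prod zero_lt_one (integrable_L2R φ)
    (integrable_L2R g) h
  have hc' : ∀ᵐ z ∂(rect a b), φ z = c z.2 + volterra n a b g z := by
    filter_upwards [hc, volterra_apply g] with z h1 h2
    rw [h1, h2]
  -- Since `[0, 1]` is not null, some slice is good in every respect. On it `c` is a difference of
  -- two `L₂` functions, which upgrades its integrability.
  have : NeBot (ae (ivl 0 1)) := by
    rw [ae_neBot]
    intro h0
    have := congrArg (fun μ : Measure ℝ => μ univ) h0
    simp at this
  obtain ⟨s, hs, hs1, hs2⟩ := ((Measure.ae_ae_of_ae_prod hc').and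
    ((memLp_slice φ).and (memLp_slice (volterra n a b g)))).exists
  have hcL : MemLp c 2 (ivl a b) := by
    refine (hs1.sub hs2).ae_eq ?_
    filter_upwards [hs] with x hx
    rw [Pi.sub_apply, hx, add_sub_cancel_right]
  refine ⟨hcL.toLp c, Lp.ext ?_⟩
  filter_upwards [hc', Lp.coeFn_add (constS n a b (hcL.toLp c)) (volterra n a b g),
    constS_apply (hcL.toLp c), Measure.quasiMeasurePreserving_snd.ae hcL.coeFn_toLp]
    with z h1 h2 h3 h4
  rw [h1, h2, Pi.add_apply, h3, h4]

/-- If a primitive in `s` is independent of `s`, integration by parts shows that every product test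
function annihilates its density, so the density is zero. Averaging over `s` then compares the
constants. -/
theorem constS_add_volterra_injective {c c' : L2 n a b} {g g' : L2R n a b}
    (h : constS n a b c + volterra n a b g = constS n a b c' + volterra n a b g') :
    c = c' ∧ g = g' := by
  have h0 : volterra n a b (g - g') = constS n a b (c' - c) := by
    rw [map_sub, map_sub, sub_eq_sub_iff_add_eq_add, add_comm, h, add_comm]
  have hg : g - g' = 0 := by
    rw [Lp.eq_zero_iff_ae_eq_zero]
    refine ae_eq_zero_of_test_prod (integrable_L2R _) fun η ζ hη hζ => ?_
    rw [← neg_eq_zero, ← integral_prod_deriv_smul_primitive (integrable_L2R (g - g')) hη hζ]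
    have h1 : ∫ z, (deriv η z.1 * ζ z.2) • (∫ σ in (0 : ℝ)..z.1, (g - g') (σ, z.2)) ∂(rect a b) =
        ∫ z, deriv η z.1 • ζ z.2 • (c' - c) z.2 ∂(rect a b) := by
      refine integral_congr_ae ?_
      filter_upwards [volterra_apply (g - g'), constS_apply (c' - c)] with z h1 h2
      rw [← h1, h0, h2, mul_smul]
    rw [h1, integral_prod_smul (μ := ivl 0 1) (ν := ivl a b) (deriv η)
      (fun x => ζ x • (c' - c) x), integral_ivl zero_le_one, hη.intervalIntegral_deriv, hη.left,
      neg_zero, zero_smul]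
  refine ⟨?_, sub_eq_zero.1 hg⟩
  have h2 := congrArg (integrateS n a b) h0
  have h3 : constS n a b (c' - c) = tensor (η := fun _ => (1 : ℝ)) continuous_const (c' - c) := by
    refine Lp.ext ?_
    filter_upwards [constS_apply (c' - c),
      tensor_apply (η := fun _ => (1 : ℝ)) continuous_const (c' - c)] with z h4 h5
    rw [h4, h5, one_smul]
  rw [hg, map_zero, map_zero, h3, integrateS_tensor] at h2
  simp only [intervalIntegral.integral_const, sub_zero, one_smul] at h2
  exact (sub_eq_zero.1 h2.symm).symm

theorem map_swap_Icc (a b : ℝ) {r t : ℝ} (hr : 0 ≤ r) (ht : t ≤ 1) :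
    ((ivl a b).prod (ivl r t)).map Prod.swap ≤ ((1 : ℝ≥0) : ℝ≥0∞) • rect a b := by
  rw [Measure.prod_swap, ENNReal.coe_one, one_smul]
  exact Measure.prod_mono (Measure.restrict_mono (Icc_subset_Icc hr ht) le_rfl) le_rfl

/-- Integration over `s ∈ [r, t]`. -/
def integrateIcc (n : ℕ) (a b : ℝ) {r t : ℝ} (hr : 0 ≤ r) (ht : t ≤ 1) :
    L2R n a b →L[ℝ] L2 n a b :=
  intOp (ivl a b) (ivl r t) ∘L pull Prod.swap measurable_swap 1 (map_swap_Icc a b hr ht)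

theorem integrateIcc_apply {r t : ℝ} (hr : 0 ≤ r) (hrt : r ≤ t) (ht : t ≤ 1) (v : L2R n a b) :
    ∀ᵐ x ∂(ivl a b), integrateIcc n a b hr ht v x = ∫ s in r..t, v (s, x) := by
  have h := map_swap_Icc a b hr ht
  filter_upwards [intOp_apply (pull Prod.swap measurable_swap 1 h v),
    Measure.ae_ae_of_ae_prod (pull_apply Prod.swap measurable_swap 1 h v)] with x h1 h2
  refine h1.trans ?_
  rw [integral_congr_ae h2, integral_ivl hrt]
  rfl

/-- Cauchy–Schwarz in `s`. The factor `√(t - r)` makes primitives along `s` Hölder continuous with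
values in `L₂`, as needed to identify `slice`. -/
theorem norm_integrateIcc_le {r t : ℝ} (hr : 0 ≤ r) (hrt : r ≤ t) (ht : t ≤ 1) (v : L2R n a b) :
    ‖integrateIcc n a b hr ht v‖ ≤ √(t - r) * ‖v‖ := by
  have h := map_swap_Icc a b hr ht
  have h1 : ‖intOp (n := n) (ivl a b) (ivl r t)‖ ≤ √(t - r) := by
    refine (LinearMap.mkContinuous_norm_le _ ENNReal.toReal_nonneg _).trans (le_of_eq ?_)
    rw [← ENNReal.toReal_rpow, Real.sqrt_eq_rpow]
    congr 1
    simp [hrt]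
  have h2 : ‖pull (n := n) Prod.swap measurable_swap 1 h‖ ≤ 1 := by
    refine (LinearMap.mkContinuous_norm_le _ ENNReal.toReal_nonneg _).trans (le_of_eq ?_)
    simp
  calc ‖integrateIcc n a b hr ht v‖
      ≤ ‖intOp (n := n) (ivl a b) (ivl r t)‖ *
        ‖pull (n := n) Prod.swap measurable_swap 1 h v‖ :=
        (intOp (ivl a b) (ivl r t)).le_opNorm (pull Prod.swap measurable_swap 1 h v)
    _ ≤ √(t - r) * (1 * ‖v‖) := by
        gcongr
        exact ContinuousLinearMap.le_of_opNorm_le _ h2 v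
    _ = √(t - r) * ‖v‖ := by rw [one_mul]

theorem integrateIcc_sub {r t : ℝ} (hr : 0 ≤ r) (hrt : r ≤ t) (ht : t ≤ 1) (v : L2R n a b) :
    integrateIcc n a b le_rfl ht v - integrateIcc n a b le_rfl (hrt.trans ht) v =
      integrateIcc n a b hr ht v := by
  refine Lp.ext ?_
  filter_upwards [integrateIcc_apply le_rfl (hr.trans hrt) ht v,
    integrateIcc_apply le_rfl hr (hrt.trans ht) v, integrateIcc_apply hr hrt ht v,
    Lp.coeFn_sub (integrateIcc n a b le_rfl ht v) (integrateIcc n a b le_rfl (hrt.trans ht) v),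
    (integrable_L2R v).prod_left_ae] with x h1 h2 h3 h4 h5
  rw [h4, Pi.sub_apply, h1, h2, h3, sub_eq_iff_eq_add',
    intervalIntegral.integral_add_adjacent_intervals]
  · exact h5.intervalIntegrable_ivl (by simp) ⟨hr, hrt.trans ht⟩
  · exact h5.intervalIntegrable_ivl ⟨hr, hrt.trans ht⟩ ⟨hr.trans hrt, ht⟩

/-- The primitive of `g` along `s` with initial value `d`, as a function with values in `L₂`. -/
def primitiveS (d : L2 n a b) (g : L2R n a b) (s : ℝ) : L2 n a b :=
  -- The cap at `1` only makes the function total; it has no effect for `s ∈ [0, 1]`.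
  d + integrateIcc n a b le_rfl (min_le_right s 1) g

theorem primitiveS_of_mem (d : L2 n a b) (g : L2R n a b) {s : ℝ} (hs : s ∈ Icc (0 : ℝ) 1) :
    primitiveS d g s = d + integrateIcc n a b le_rfl hs.2 g := by
  simp only [primitiveS, min_eq_left hs.2]

theorem norm_primitiveS_sub_le (d : L2 n a b) (g : L2R n a b) {r t : ℝ} (hr : r ∈ Icc (0 : ℝ) 1)
    (ht : t ∈ Icc (0 : ℝ) 1) : ‖primitiveS d g t - primitiveS d g r‖ ≤ √|t - r| * ‖g‖ := by
  wlog hrt : r ≤ t generalizing r t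
  · rw [norm_sub_rev, abs_sub_comm]
    exact this ht hr (le_of_not_ge hrt)
  rw [primitiveS_of_mem d g hr, primitiveS_of_mem d g ht, add_sub_add_left_eq_sub,
    integrateIcc_sub hr.1 hrt ht.2, abs_of_nonneg (sub_nonneg.2 hrt)]
  exact norm_integrateIcc_le hr.1 hrt ht.2 g

theorem continuousOn_primitiveS (d : L2 n a b) (g : L2R n a b) :
    ContinuousOn (primitiveS d g) (Icc 0 1) := by
  intro r hr
  rw [ContinuousWithinAt, tendsto_iff_norm_sub_tendsto_zero]
  refine squeeze_zero' (Eventually.of_forall fun _ => norm_nonneg _) (g := fun t => √|t - r| * ‖g‖)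
    ?_ ?_
  · filter_upwards [self_mem_nhdsWithin] with t ht
    exact norm_primitiveS_sub_le d g hr ht
  · have hc : Continuous fun t => √|t - r| * ‖g‖ := by fun_prop
    have := hc.tendsto r
    simp only [sub_self, abs_zero, Real.sqrt_zero, zero_mul] at this
    exact this.mono_left nhdsWithin_le_nhds

theorem primitiveS_zero (d : L2 n a b) (g : L2R n a b) : primitiveS d g 0 = d := by
  rw [primitiveS_of_mem d g (by simp), add_eq_left, ← norm_le_zero_iff]
  simpa using norm_integrateIcc_le le_rfl le_rfl zero_le_one g

theorem primitiveS_one (d : L2 n a b) (g : L2R n a b) :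
    primitiveS d g 1 = d + integrateS n a b g := by
  rw [primitiveS_of_mem d g (by simp)]
  rfl

theorem primitiveS_apply (d : L2 n a b) (g : L2R n a b) :
    ∀ᵐ s ∂(ivl 0 1), ∀ᵐ x ∂(ivl a b),
      (constS n a b d + volterra n a b g) (s, x) = primitiveS d g s x := by
  filter_upwards [Measure.ae_ae_of_ae_prod (Lp.coeFn_add (constS n a b d) (volterra n a b g)),
    Measure.ae_ae_of_ae_prod (constS_apply d), Measure.ae_ae_of_ae_prod (volterra_apply g),
    ae_mem_ivl 0 1] with s h1 h2 h3 hs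
  rw [primitiveS_of_mem d g hs]
  filter_upwards [h1, h2, h3, integrateIcc_apply le_rfl hs.1 hs.2 g,
    Lp.coeFn_add d (integrateIcc n a b le_rfl hs.2 g)] with x h4 h5 h6 h7 h8
  rw [h4, h8, Pi.add_apply, Pi.add_apply, h5, h6, h7]

/-- Continuous representatives that agree for almost every `s` agree on all of `[0, 1]`, so the
choice made in `slice` is immaterial. -/
theorem slice_eq {φ : L2R n a b} {Φ : ℝ → L2 n a b} (hc : ContinuousOn Φ (Icc 0 1))
    (h : ∀ᵐ r ∂(ivl 0 1), ∀ᵐ x ∂(ivl a b), φ (r, x) = Φ r x) {s : ℝ} (hs : s ∈ Icc (0 : ℝ) 1) :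
    slice φ s = Φ s := by
  have h' := Classical.epsilon_spec (p := fun Φ : ℝ → L2 n a b =>
    ContinuousOn Φ (Icc 0 1) ∧ ∀ᵐ r ∂(ivl 0 1), ∀ᵐ x ∂(ivl a b), φ (r, x) = Φ r x) ⟨Φ, hc, h⟩
  refine Measure.eqOn_Icc_of_ae_eq volume zero_ne_one ?_ h'.1 hc hs
  filter_upwards [h, h'.2] with r h1 h2
  refine Lp.ext ?_
  filter_upwards [h1, h2] with x h3 h4
  exact h4.symm.trans h3

/-- Primitives along `x`, on almost every slice. -/
theorem exists_eq_primitive_slice (hab : a < b) {φ g : L2R n a b}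
    (h : ∀ η ζ, IsTest 0 1 η → IsTest a b ζ →
      ∫ z, (η z.1 * deriv ζ z.2) • φ z ∂(rect a b) = -∫ z, (η z.1 * ζ z.2) • g z ∂(rect a b)) :
    ∃ c : ℝ → Vec n, ∀ᵐ s ∂(ivl 0 1), ∀ᵐ x ∂(ivl a b),
      φ (s, x) = c s + ∫ y in a..x, g (s, y) := by
  obtain ⟨c, hc⟩ := exists_eq_add_primitive_prod (p := a) (q := b) (r := 0) (t := 1)
    (f := fun z => φ z.swap) (g := fun z => g z.swap) hab (integrable_L2R φ).swap
    (integrable_L2R g).swap fun ζ η hζ hη => by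
      have h1 := h η ζ hη hζ
      rw [← integral_prod_swap (μ := ivl 0 1) (ν := ivl a b),
        ← integral_prod_swap (μ := ivl 0 1) (ν := ivl a b)] at h1
      simpa only [Prod.fst_swap, Prod.snd_swap, mul_comm (η _)] using h1
  exact ⟨c, Measure.ae_ae_of_ae_prod
    (p := fun z : ℝ × ℝ => φ z = c z.1 + ∫ y in a..z.2, g (z.1, y))
    (Measure.measurePreserving_swap.quasiMeasurePreserving.ae hc)⟩

end WeakDerivR

/-! ### Representation of the delayed state -/

namespace DPDE

variable {n : ℕ} (D : DPDE n)

/-- The delayed state in terms of `u_xx` and `ψ = ∂ₛ ∂ₓ² φ`. -/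
theorem exists_of_mem_Y (hBH : IsUnit (D.B * D.H)) {u : L2 n D.a D.b} {φ : L2R n D.a D.b}
    (hφ : φ ∈ D.Y u) :
    ∃ ψ : L2R n D.a D.b,
      φ = constS n D.a D.b u + volterra n D.a D.b (D.paramsT.lift ψ) ∧
      weakDerivR 1 0 φ = D.paramsT.lift ψ ∧
      weakDeriv 2 (slice φ 1) = weakDeriv 2 u + integrateS n D.a D.b ψ := by
  obtain ⟨hS, h0, hXB⟩ := hφ
  have hd := fun i hi j hj => hasWeakDerivR_weakDerivR (hS i hi j hj)
  obtain ⟨d, hφd⟩ : ∃ d, φ = constS n D.a D.b d + volterra n D.a D.b (weakDerivR 1 0 φ) := by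
    refine exists_eq_constS_add_volterra fun η ζ hη hζ => ?_
    simpa using (hd 1 le_rfl 0 (by norm_num)).integral_prod hη hζ
  obtain ⟨c, hc⟩ : ∃ c, weakDerivR 0 2 φ =
      constS n D.a D.b c + volterra n D.a D.b (weakDerivR 1 2 φ) := by
    refine exists_eq_constS_add_volterra fun η ζ hη hζ => ?_
    -- Testing `φ_xx` with `η' ζ` and `ψ = ∂ₛ∂ₓ²φ` with `η ζ` shows that `ψ` is the `s`-derivative
    -- of `φ_xx`.
    have h1 := (hd 0 (by norm_num) 2 le_rfl).integral_prod hη.deriv hζ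
    have h2 := (hd 1 le_rfl 2 le_rfl).integral_prod hη hζ
    rw [iteratedDeriv_one] at h2
    rw [iteratedDeriv_zero, h2] at h1
    norm_num at h1
    exact h1.symm
  obtain ⟨β, hβ⟩ : ∃ β : ℝ → Vec n, ∀ᵐ s ∂(ivl 0 1), ∀ᵐ x ∂(ivl D.a D.b),
      φ (s, x) = β s + ∫ y in D.a..x, weakDerivR 0 1 φ (s, y) := by
    refine exists_eq_primitive_slice D.hab fun η ζ hη hζ => ?_
    simpa using (hd 0 (by norm_num) 1 (by norm_num)).integral_prod hη hζ
  obtain ⟨γ, hγ⟩ : ∃ γ : ℝ → Vec n, ∀ᵐ s ∂(ivl 0 1), ∀ᵐ x ∂(ivl D.a D.b),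
      weakDerivR 0 1 φ (s, x) = γ s + ∫ y in D.a..x, weakDerivR 0 2 φ (s, y) := by
    refine exists_eq_primitive_slice D.hab fun η ζ hη hζ => ?_
    have h1 := (hd 0 (by norm_num) 1 (by norm_num)).integral_prod hη hζ.deriv
    have h2 := (hd 0 (by norm_num) 2 le_rfl).integral_prod hη hζ
    rw [iteratedDeriv_succ, iteratedDeriv_one] at h2
    rw [iteratedDeriv_one, h2] at h1
    norm_num at h1
    rw [h1, neg_neg]
  have hae : ∀ᵐ s ∂(ivl 0 1), ∀ᵐ x ∂(ivl D.a D.b),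
      φ (s, x) = primitiveS d (weakDerivR 1 0 φ) s x := by
    have := primitiveS_apply d (weakDerivR 1 0 φ)
    rwa [← hφd] at this
  have hsl : ∀ s ∈ Icc (0 : ℝ) 1, slice φ s = primitiveS d (weakDerivR 1 0 φ) s :=
    fun s hs => slice_eq (continuousOn_primitiveS _ _) hae hs
  have hdu : d = u := by
    rw [← h0, hsl 0 (by simp), primitiveS_zero]
  -- For almost every `s` the slice `φ(s, ·)` lies in `X_B` and has second derivative `φ_xx(s, ·)`,
  -- so the one-variable inversion applies slice by slice.
  have hlift : D.paramsT.lift (weakDerivR 0 2 φ) = φ := by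
    refine ext_slices ?_
    filter_upwards [hae, hβ, hγ, memLp_slice (weakDerivR 0 2 φ),
      (integrable_L2R (weakDerivR 0 1 φ)).prod_right_ae,
      D.paramsT.lift_slice (weakDerivR 0 2 φ), ae_mem_ivl 0 1] with s h1 h2 h3 h4 h5 h6 hs
    rw [← hsl s hs] at h1
    have hw : HasWeakDeriv 2 (slice φ s) (h4.toLp _) := by
      refine hasWeakDeriv_two_of_primitive h5 (c := β s) (d := γ s) ?_ ?_
      · filter_upwards [h1, h2] with x h7 h8
        rw [← h7, h8]
      · filter_upwards [h3, ae_mem_ivl D.a D.b] with x h7 hx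
        rw [h7, intervalIntegral_congr_ivl h4.coeFn_toLp (left_mem_Icc.2 D.hab.le) hx]
    have hop := D.opT1_weakDeriv hBH (hXB s hs)
    rw [hw.weakDeriv_eq] at hop
    have h7 := h6 (h4.toLp _) (by
      filter_upwards [h4.coeFn_toLp] with x hx
      exact hx.symm)
    rw [hop] at h7
    filter_upwards [h7, h1] with x h8 h9
    rw [h8, h9]
  -- Applying `𝒯₁` to `φ_xx = c + ∫₀ˢ ψ` and commuting it with the integral gives a second
  -- decomposition of `φ`, to be compared with `φ = d + ∫₀ˢ φₛ`.
  have hdec : constS n D.a D.b (D.paramsT.op c) +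
      volterra n D.a D.b (D.paramsT.lift (weakDerivR 1 2 φ)) =
      constS n D.a D.b d + volterra n D.a D.b (weakDerivR 1 0 φ) := by
    rw [← hφd, ← D.paramsT.lift_constS, D.paramsT.volterra_lift, ← map_add, ← hc, hlift]
  obtain ⟨hcd, h10⟩ := constS_add_volterra_injective hdec
  refine ⟨weakDerivR 1 2 φ, ?_, h10.symm, ?_⟩
  · rw [h10, ← hdu, ← hφd]
  -- The slice at `1` equals `𝒯₁(c + ∫₀¹ ψ)`, while `u = 𝒯₁ c`; `∂ₓ²` undoes `𝒯₁` in both.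
  · rw [hsl 1 (by simp), primitiveS_one, ← h10, D.paramsT.integrateS_lift, ← hcd, ← map_add,
      (D.hasWeakDeriv_opT1 _).weakDeriv_eq, ← hdu, ← hcd, (D.hasWeakDeriv_opT1 _).weakDeriv_eq]

end DPDE

/-! ### Lyapunov estimate -/

/-- Exponential decay from a quadratic Lyapunov function. -/
theorem norm_le_of_lyapunov {E : Type*} [NormedAddCommGroup E] [InnerProductSpace ℝ E]
    [CompleteSpace E] {P : E →L[ℝ] E} (hP : IsSelfAdjoint P) {ε α : ℝ} (hε : 0 < ε)
    {x x' : ℝ → E} (hPε : ∀ y, ε ^ 2 * ‖y‖ ^ 2 ≤ inner ℝ (P y) y)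
    (hx : ∀ t ≥ 0, HasDerivWithinAt x (x' t) (Ici 0) t)
    (hdec : ∀ t ≥ 0, 2 * inner ℝ (P (x t)) (x' t) ≤ -(2 * α) * inner ℝ (P (x t)) (x t))
    {t : ℝ} (ht : 0 ≤ t) :
    ‖x t‖ ≤ (√‖P‖ / ε) * ‖x 0‖ * Real.exp (-α * t) := by
  have hsymm : ∀ y z : E, inner ℝ (P y) z = inner ℝ y (P z) :=
    (ContinuousLinearMap.isSelfAdjoint_iff_isSymmetric.1 hP)
  let V : ℝ → ℝ := fun t => inner ℝ (P (x t)) (x t)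
  have hV : ∀ t ≥ 0, HasDerivWithinAt V (2 * inner ℝ (P (x t)) (x' t)) (Ici 0) t := by
    intro t ht
    have h1 := (P.hasFDerivAt.comp_hasDerivWithinAt t (hx t ht)).inner ℝ (hx t ht)
    refine h1.congr_deriv ?_
    rw [hsymm (x' t), real_inner_comm (P (x t)) (x' t), two_mul]
    rfl
  -- The integrating factor turns `V' ≤ -2αV` into monotonicity, which needs no integrability of the
  -- derivative.
  let W : ℝ → ℝ := fun t => Real.exp (2 * α * t) * V t
  have hW : ∀ t ≥ 0, HasDerivWithinAt W (Real.exp (2 * α * t) *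
      (2 * α * V t + 2 * inner ℝ (P (x t)) (x' t))) (Ici 0) t := by
    intro t ht
    have h1 : HasDerivWithinAt (fun t => Real.exp (2 * α * t))
        (Real.exp (2 * α * t) * (2 * α)) (Ici 0) t := by
      simpa using (((hasDerivAt_id t).const_mul (2 * α)).exp).hasDerivWithinAt
    refine (h1.mul (hV t ht)).congr_deriv ?_
    ring
  have hanti : AntitoneOn W (Ici 0) := by
    refine antitoneOn_of_hasDerivWithinAt_nonpos (convex_Ici 0)
      (fun t ht => (hW t ht).continuousWithinAt)
      (fun t ht => (hW t (interior_subset ht)).mono interior_subset) fun t ht => ?_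
    refine mul_nonpos_of_nonneg_of_nonpos (Real.exp_pos _).le ?_
    have := hdec t (interior_subset ht)
    change 2 * α * inner ℝ (P (x t)) (x t) + _ ≤ 0
    linarith
  have h1 : Real.exp (2 * α * t) * V t ≤ V 0 := by
    simpa [W] using hanti self_mem_Ici ht ht
  have h2 : V 0 ≤ ‖P‖ * ‖x 0‖ ^ 2 := by
    refine (real_inner_le_norm _ _).trans ?_
    rw [pow_two, ← mul_assoc]
    exact mul_le_mul_of_nonneg_right (P.le_opNorm _) (norm_nonneg _)
  have h3 : (ε * ‖x t‖ * Real.exp (α * t)) ^ 2 ≤ (√‖P‖ * ‖x 0‖) ^ 2 := by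
    rw [mul_pow, mul_pow, mul_pow, Real.sq_sqrt (norm_nonneg _), ← Real.exp_nat_mul]
    refine le_trans ?_ (h1.trans h2)
    rw [mul_comm]
    refine mul_le_mul (le_of_eq ?_) (hPε _) (by positivity) (Real.exp_pos _).le
    congr 1
    push_cast
    ring
  have h4 := (sq_le_sq₀ (by positivity) (by positivity)).1 h3
  have h5 : √‖P‖ / ε * ‖x 0‖ * Real.exp (-α * t) =
      (√‖P‖ * ‖x 0‖) / (ε * Real.exp (α * t)) := by
    rw [neg_mul, Real.exp_neg]
    field_simp
  rw [h5, le_div_iff₀ (by positivity)]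
  linarith

/-! ### Solutions in terms of `𝒯` and `𝒜` -/

namespace DPDE

variable {n : ℕ}

/-- Along a solution, the state is `𝒯 z` and its time derivative is `𝒜 z` for some `z`. -/
theorem IsSolution.exists_state {D : DPDE n} (hBH : IsUnit (D.B * D.H)) {u₀ : L2 n D.a D.b}
    {φ₀ : L2R n D.a D.b} {u : ℝ → L2 n D.a D.b} {φ : ℝ → L2R n D.a D.b}
    (hsol : D.IsSolution u₀ φ₀ u φ) {t : ℝ} (ht : 0 ≤ t) :
    ∃ z : Z n D.a D.b, D.opT z = WithLp.toLp 2 (u t, φ t) ∧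
      HasDerivWithinAt (fun t => (WithLp.toLp 2 (u t, φ t) : Z n D.a D.b)) (D.opA z) (Ici 0) t := by
  obtain ⟨ψ, hφ, hs, h1⟩ := D.exists_of_mem_Y hBH (hsol.mem_Y t ht)
  have hu := hsol.mem_XB t ht
  have hu1 := (hsol.mem_Y t ht).2.2 1 (by simp)
  obtain ⟨u', hu', hae⟩ := hsol.deriv_u t ht
  refine ⟨WithLp.toLp 2 (weakDeriv 2 (u t), ψ), ?_, ?_⟩
  · change WithLp.toLp 2 (D.paramsT.op (weakDeriv 2 (u t)) + 0,
      constS n D.a D.b (D.paramsT.op (weakDeriv 2 (u t))) +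
        volterra n D.a D.b (D.paramsT.lift ψ)) = _
    rw [D.opT1_weakDeriv hBH hu, ← hφ, add_zero]
  · have hA : D.opA (WithLp.toLp 2 (weakDeriv 2 (u t), ψ)) =
        WithLp.toLp 2 (u', -(1 / D.τ) • weakDerivR 1 0 (φ t)) := by
      change WithLp.toLp 2 ((D.paramsA.op (weakDeriv 2 (u t)) +
        D.paramsAd.op (weakDeriv 2 (u t))) + integrateS n D.a D.b (D.paramsAd.lift ψ),
        0 + -(1 / D.τ) • D.paramsT.lift ψ) = _
      -- The delay terms combine: `𝒫_{A_d} u_xx + ∫₀¹ 𝒫_{A_d} ψ = 𝒫_{A_d}(u_xx + ∫₀¹ ψ) = 𝒫_{A_d}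
      -- φ_xx(1)`.
      rw [zero_add, ← hs, D.paramsAd.integrateS_lift, add_assoc, ← map_add, ← h1]
      congr 2
      refine Lp.ext ?_
      filter_upwards [hae, D.dynParams_op_weakDeriv hBH D.hA hu,
        D.dynParams_op_weakDeriv hBH D.hAd hu1,
        Lp.coeFn_add (D.paramsA.op (weakDeriv 2 (u t)))
          (D.paramsAd.op (weakDeriv 2 (slice (φ t) 1)))] with x e1 e2 e3 e4
      rw [e4, e1, Pi.add_apply, paramsA, paramsAd, e2, e3]
      rfl
    rw [hA]
    exact (WithLp.prodContinuousLinearEquiv 2 ℝ (L2 n D.a D.b) (L2R n D.a D.b)).symm.hasFDerivAt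
      |>.comp_hasDerivWithinAt t (hu'.prodMk (hsol.deriv_φ t ht))

end DPDE

end DelayPDE

end

theorem mainTheorem1 {n : ℕ} (D : DelayPDE.DPDE n) (hBH : IsUnit (D.B * D.H))
    (ε α : ℝ) (hε : 0 < ε) (hα : 0 < α)
    (P : DelayPDE.Z n D.a D.b →L[ℝ] DelayPDE.Z n D.a D.b)
    (hP : IsSelfAdjoint P)
    (hPε : ε ^ 2 • ContinuousLinearMap.id ℝ (DelayPDE.Z n D.a D.b) ≤ P)
    (hLPI : D.opA.adjoint ∘L P ∘L D.opT + D.opT.adjoint ∘L P ∘L D.opA ≤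
      -(2 * α) • (D.opT.adjoint ∘L P ∘L D.opT))
    (u₀ : DelayPDE.L2 n D.a D.b) (φ₀ : DelayPDE.L2R n D.a D.b)
    (u : ℝ → DelayPDE.L2 n D.a D.b) (φ : ℝ → DelayPDE.L2R n D.a D.b)
    (hsol : D.IsSolution u₀ φ₀ u φ) :
    ∀ t ≥ 0, ‖(WithLp.toLp 2 (u t, φ t) : DelayPDE.Z n D.a D.b)‖ ≤
      (√‖P‖ / ε) * ‖(WithLp.toLp 2 (u 0, φ 0) : DelayPDE.Z n D.a D.b)‖ * Real.exp (-α * t) := by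
  intro t ht
  have hz := fun t : {t : ℝ // 0 ≤ t} => hsol.exists_state hBH t.2
  choose z hzT hzA using hz
  have hsymm : ∀ y w, inner ℝ (P y) w = inner ℝ y (P w) :=
    ContinuousLinearMap.isSelfAdjoint_iff_isSymmetric.1 hP
  refine DelayPDE.norm_le_of_lyapunov hP hε
    (x := fun t => (WithLp.toLp 2 (u t, φ t) : DelayPDE.Z n D.a D.b))
    (x' := fun t => if h : 0 ≤ t then D.opA (z ⟨t, h⟩) else 0) (fun y => ?_) (fun s hs => ?_)
    (fun s hs => ?_) ht
  · have h := (ContinuousLinearMap.le_def _ _).1 hPε |>.inner_nonneg_left y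
    simp only [sub_apply, smul_apply, ContinuousLinearMap.id_apply, inner_sub_left,
      real_inner_smul_left, real_inner_self_eq_norm_sq] at h
    linarith
  · rw [dif_pos (show 0 ≤ s from hs)]
    exact hzA ⟨s, hs⟩
  · simp only [dif_pos (show 0 ≤ s from hs), ← hzT ⟨s, hs⟩]
    -- Testing the operator inequality at `z` and moving the adjoints gives two cross terms.
    -- Symmetry of `P` makes each equal to `⟨P 𝒯z, 𝒜z⟩`.
    have h := (ContinuousLinearMap.le_def _ _).1 hLPI |>.inner_nonneg_left (z ⟨s, hs⟩)
    simp only [sub_apply, smul_apply,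
      add_apply, ContinuousLinearMap.comp_apply, inner_sub_left,
      inner_add_left, real_inner_smul_left, ContinuousLinearMap.adjoint_inner_left] at h
    rw [hsymm (D.opA (z ⟨s, hs⟩)),
      real_inner_comm (P (D.opT (z ⟨s, hs⟩))) (D.opA (z ⟨s, hs⟩))] at h
    linarith
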